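/- Let $\rho_l,\mu_l,\kappa_g,c_v,R_g,T_\infty,\sigma,\bar\sigma,V,M>0$ (liquid density, liquid viscosity, thermal conductivity and specific heat of the gas, gas constant, external temperature, the two surface tensions, liquid volume, gas mass), $\gamma=1+R_g/c_v$ and $\bar V=3V/(4\pi)$. Let $(\rho_\dagger,R_\dagger)\in(0,\infty)^2$ be an equilibrium: with $\bar R_\dagger=(R_\dagger^3+\bar V)^{1/3}$, $$\frac{4\pi}{3}\rho_\dagger R_\dagger^3=M,\qquad \rho_\dagger=\frac{2}{R_gT_\infty}\Big(\frac{\sigma}{R_\dagger}+\frac{\bar\sigma}{\bar R_\dagger}\Big).$$ Put $\tilde R=R_\dagger-R_\dagger^2/\bar R_\dagger$, $\bar\kappa=\kappa_g/(R_\dagger^2\rho_\dagger\gamma c_v)$, $A=\frac{2\sigma}{R_\dagger^2}+\frac{2\bar\sigma R_\dagger^2}{\bar R_\dagger^4}$, $B=\frac{4\mu_l\bar V}{R_\dagger(R_\dagger^3+\bar V)}$, $C=\rho_l\tilde R$, $Q(\lambda)=C\lambda^2+B\lambda-A$, $S=3\gamma\rho_\dagger/R_\dagger$, and for $k\ge1$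 $$c_k=\frac{(-1)^{k-1}2^{3/2}(\gamma-1)}{\sqrt\pi\,\gamma k},\qquad \omega_k=-\frac{R_\dagger\bar\kappa}{\rho_\dagger}\sqrt{\frac{\pi}{2}}\,(-1)^kk .$$ Let $\mathcal L$ be the linear operator on the complex space $\ell^2$ which maps $z=(z_1,z_2,z_3,\theta_1,\theta_2,\dots)$ to $(w_1,w_2,w_3,\eta_1,\eta_2,\dots)$ with $$w_1=S\Big(\sum_{j\ge1}\omega_j\theta_j-z_3\Big),\quad w_2=z_3,\quad w_3=\frac{R_gT_\infty z_1+Az_2-Bz_3}{C},\quad \eta_k=-c_kS\Big(\sum_{j\ge1}\omega_j\theta_j-z_3\Big)-\pi^2\bar\kappa k^2\theta_k,$$ on its maximal domain, i.e. all $z\in\ell^2$ for which the series converges absolutely and $\mathcal Lz\in\ell^2$. A number $\lambda$ belongs to the spectrum $\operatorname{sp}(\mathcal L)$ unless $\mathcal L-\lambda$ has an everywhere defined bounded inverse. Let $$\mathbb M(\lambda)=\frac{\pi}{R_gT_\infty\gamma}\Big(\frac43+\sum_{k=1}^\infty\frac{8(\gamma-1)\bar\kappa}{\pi^2\bar\kappa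 k^2+\lambda}\Big)Q(\lambda)+4\pi\frac{\rho_\dagger}{R_\dagger},\qquad \lambda\notin\{-\pi^2\bar\kappa k^2:k\ge1\}.$$ Then: (1) $\mathbb M$ is meromorphic on $\mathbb C$, and $$\operatorname{sp}(\mathcal L)=\{0\}\cup\{\lambda\in\mathbb C\setminus\{-\pi^2\bar\kappa k^2:k\ge1\}:\mathbb M(\lambda)=0\}\cup\{-\pi^2\bar\kappa k^2: k\ge1,\ Q(-\pi^2\bar\kappa k^2)=0\}.$$ In particular, if $Q(-\pi^2\bar\kappa k^2)\ne0$ for all $k\ge1$ (which holds for all parameters outside an exceptional set), then $\operatorname{sp}(\mathcal L)$ consists of $0$ and the zeros of $\mathbb M$. (2) $0$ is a simple eigenvalue: $\ker\mathcal L$ and $\bigcup_n\ker\mathcal L^n$ are one-dimensional. (3) There is a constant $\varpi>0$ with $\sup\{\operatorname{Re}\lambda:\lambda\in\operatorname{sp}(\mathcal L)\setminus\{0\}\}\le-2\varpi$. Explicitly, with $$K=\frac{2R_gT_\infty\rho_\dagger\bar R_\dagger}{\rho_lR_\dagger^2(\bar R_\dagger-R_\dagger)},\quad q=\frac{3R_gT_\infty\rho_\dagger\gamma}{R_\dagger(KC+A)},\quad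 \Theta_1=1-\sqrt{\frac{\gamma-1}{q-1}},\quad \Theta_2=1-\frac{\gamma-1}{q-1},\quad \delta=\frac{(\gamma-1)\bar\kappa K}{2\gamma}\sum_{j=1}^\infty\frac{1}{\pi^4\bar\kappa^2j^4+K/2},$$ one can take $$\varpi=\begin{cases}\dfrac12\min\Big\{\Theta_2\pi^2\bar\kappa,\ \max\Big\{\dfrac{B}{2C},\min\Big\{\Theta_1\pi^2\bar\kappa,\sqrt{K/2}\Big\}\Big\},\ \dfrac{B}{2C}+\delta\Big\}, & B^2\le4KC^2,\\[2ex] \dfrac12\min\Big\{\Theta_2\pi^2\bar\kappa,\ \dfrac{B-\sqrt{B^2-4KC^2}}{2C}\Big\}, & B^2>4KC^2.\end{cases}$$ -/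

import Mathlib

noncomputable section

/-! ### Unbounded operators: resolvent set, spectrum, generalized eigenspaces -/

namespace UnboundedOp

variable {H : Type*} [NormedAddCommGroup H] [NormedSpace ℂ H]

/-- `z` is in the resolvent set of `T : D(T) ⊆ H → H` if `T - z : D(T) → H` is bijective with
an everywhere defined bounded inverse `S`. -/
def IsResolventPoint (T : H →ₗ.[ℂ] H) (z : ℂ) : Prop :=
  ∃ S : H →L[ℂ] H,
    (∀ y : H, ∃ h : S y ∈ T.domain, T ⟨S y, h⟩ - z • S y = y) ∧
    (∀ x : T.domain, S (T x - z • (x : H)) = x)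

/-- The spectrum of a (possibly unbounded) operator. -/
def spectrum (T : H →ₗ.[ℂ] H) : Set ℂ := {z | ¬ IsResolventPoint T z}

/-- `genKer T z n = ker (T - z)^n`, i.e. the vectors of `D((T - z)^n)` killed by `(T - z)^n`. -/
def genKer (T : H →ₗ.[ℂ] H) (z : ℂ) : ℕ → Submodule ℂ H
  | 0 => ⊥
  | n + 1 => Submodule.map T.domain.subtype
      (Submodule.comap (T.toFun - z • T.domain.subtype) (genKer T z n))

/-- The eigenspace `ker (T - z)`. -/
def eigenspace (T : H →ₗ.[ℂ] H) (z : ℂ) : Submodule ℂ H := genKer T z 1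

/-- The generalized eigenspace `⋃ₙ ker (T - z)^n`; its dimension is the algebraic
multiplicity of the eigenvalue `z`. -/
def genEigenspace (T : H →ₗ.[ℂ] H) (z : ℂ) : Submodule ℂ H := ⨆ n, genKer T z n

end UnboundedOp

/-! ### The operator on `ℓ²` given by an infinite matrix -/

/-- The complex Hilbert space `ℓ²` of square summable sequences indexed by `ℕ`. -/
abbrev EllTwo : Type := lp (fun _ : ℕ => ℂ) 2

/-- The operator on `ℓ²` given by the infinite matrix `A`, on its natural (maximal) domain: all
`x ∈ ℓ²` for which every row sum `∑ⱼ Aᵢⱼ xⱼ` converges (absolutely) and `A x ∈ ℓ²`. -/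
def matrixOperator (A : Matrix ℕ ℕ ℂ) : EllTwo →ₗ.[ℂ] EllTwo where
  domain :=
    { carrier := {x | (∀ i, Summable fun j => A i j * x j) ∧
        Memℓp (fun i => ∑' j, A i j * x j) 2}
      add_mem' := by
        rintro x y ⟨hx, hx'⟩ ⟨hy, hy'⟩
        refine ⟨fun i => ?_, ?_⟩
        · simpa [mul_add] using (hx i).add (hy i)
        · have h := hx'.add hy'
          convert h using 1
          ext i
          simp only [lp.coeFn_add, Pi.add_apply, mul_add]
          exact (hx i).tsum_add (hy i)
      zero_mem' := by
        refine ⟨fun i => ?_, ?_⟩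
        · simp
        · convert (zero_memℓp : Memℓp (0 : ℕ → ℂ) 2) using 1
          ext i
          simp
      smul_mem' := by
        rintro c x ⟨hx, hx'⟩
        refine ⟨fun i => ?_, ?_⟩
        · simpa [mul_left_comm] using (hx i).mul_left c
        · have h := hx'.const_smul c
          convert h using 1
          ext i
          simp only [lp.coeFn_smul, Pi.smul_apply, smul_eq_mul, mul_left_comm _ c]
          exact tsum_mul_left }
  toFun :=
    { toFun := fun x => ⟨fun i => ∑' j, A i j * (x : EllTwo) j, x.2.2⟩
      map_add' := by
        intro x y
        ext i
        simp only [Submodule.coe_add, lp.coeFn_add, Pi.add_apply, mul_add]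
        exact (x.2.1 i).tsum_add (y.2.1 i)
      map_smul' := by
        intro c x
        ext i
        simp only [Submodule.coe_smul, lp.coeFn_smul, Pi.smul_apply, smul_eq_mul,
          mul_left_comm _ c, RingHom.id_apply]
        exact tsum_mul_left }

theorem matrixOperator_apply (A : Matrix ℕ ℕ ℂ) (x : (matrixOperator A).domain) (i : ℕ) :
    (matrixOperator A x : EllTwo) i = ∑' j, A i j * (x : EllTwo) j := rfl

/-! ### The gas bubble in a bounded liquid: physical parameters and equilibria -/

/-- The physical constants of the gas-liquid system, all positive. -/
structure GasLiquidParams where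
  /-- liquid density `ρ_l` -/
  liqDensity : ℝ
  /-- dynamic viscosity `μ_l` of the liquid -/
  visc : ℝ
  /-- thermal conductivity `κ_g` of the gas -/
  thermal : ℝ
  /-- specific heat capacity `c_v` of the gas -/
  heatCap : ℝ
  /-- specific gas constant `R_g` -/
  gasConst : ℝ
  /-- external temperature `T_∞` -/
  temp : ℝ
  /-- surface tension coefficient `σ` of the gas-liquid interface -/
  sig : ℝ
  /-- surface tension coefficient `σ̄` of the external free surface -/
  sigBar : ℝ
  /-- liquid volume `V` -/
  vol : ℝ
  /-- gas mass `M` -/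
  mass : ℝ
  liqDensity_pos : 0 < liqDensity
  visc_pos : 0 < visc
  thermal_pos : 0 < thermal
  heatCap_pos : 0 < heatCap
  gasConst_pos : 0 < gasConst
  temp_pos : 0 < temp
  sig_pos : 0 < sig
  sigBar_pos : 0 < sigBar
  vol_pos : 0 < vol
  mass_pos : 0 < mass

namespace GasLiquidParams

/-- The adiabatic constant `γ = 1 + R_g / c_v`. -/
def adi (p : GasLiquidParams) : ℝ := 1 + p.gasConst / p.heatCap

/-- The modified liquid volume `V̄ = 3V / (4π)`. -/
def volBar (p : GasLiquidParams) : ℝ := 3 * p.vol / (4 * Real.pi)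

/-- The external radius `(R³ + V̄)^(1/3)` of the gas-liquid region when the gas bubble has
radius `R`. -/
def outer (p : GasLiquidParams) (R : ℝ) : ℝ := (R ^ 3 + p.volBar) ^ (1 / 3 : ℝ)

/-- A spherically symmetric equilibrium with gas mass `M` and liquid volume `V`: gas radius
`R > 0` and (constant) gas density `ρ > 0` such that the gas mass is `M` and the gas pressure
`R_g T_∞ ρ` balances the surface tensions. -/
structure Equilibrium (p : GasLiquidParams) where
  /-- equilibrium radius of the bubble -/
  rad : ℝ
  /-- equilibrium gas density -/
  dens : ℝ
  rad_pos : 0 < rad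
  dens_pos : 0 < dens
  mass_eq : 4 * Real.pi / 3 * dens * rad ^ 3 = p.mass
  balance : dens = 2 / (p.gasConst * p.temp) * (p.sig / rad + p.sigBar / p.outer rad)

namespace Equilibrium

variable {p : GasLiquidParams}

/-- The external equilibrium radius. -/
def out (E : p.Equilibrium) : ℝ := p.outer E.rad

/-- `R̃ = R - R² / R_out`. -/
def radTilde (E : p.Equilibrium) : ℝ := E.rad - E.rad ^ 2 / E.out

/-- `κ̄ = κ_g / (R² ρ γ c_v)`. -/
def kap (E : p.Equilibrium) : ℝ :=
  p.thermal / (E.rad ^ 2 * E.dens * p.adi * p.heatCap)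

/-- `A = 2σ/R² + 2σ̄R²/R_out⁴`. -/
def cA (E : p.Equilibrium) : ℝ :=
  2 * p.sig / E.rad ^ 2 + 2 * p.sigBar * E.rad ^ 2 / E.out ^ 4

/-- `B = 4μ_l V̄ / (R (R³ + V̄))`. -/
def cB (E : p.Equilibrium) : ℝ :=
  4 * p.visc * p.volBar / (E.rad * (E.rad ^ 3 + p.volBar))

/-- `C = ρ_l R̃`. -/
def cC (E : p.Equilibrium) : ℝ := p.liqDensity * E.radTilde

/-- `K = 2 R_g T_∞ ρ R_out / (ρ_l R² (R_out - R))`. -/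
def cK (E : p.Equilibrium) : ℝ :=
  2 * p.gasConst * p.temp * E.dens * E.out /
    (p.liqDensity * E.rad ^ 2 * (E.out - E.rad))

/-- The Dirichlet eigenvalues `(kπ)²`. -/
def eigv (k : ℕ) : ℝ := (k * Real.pi) ^ 2

/-- `c_k = (-1)^(k-1) 2^(3/2) (γ - 1) / (√π γ k)`, for `k ≥ 1`. -/
def coeff (_E : p.Equilibrium) (k : ℕ) : ℝ :=
  (-1) ^ (k - 1) * (2 : ℝ) ^ (3 / 2 : ℝ) * (p.adi - 1) / (√Real.pi * p.adi * k)

/-- `ω_j = -(R κ̄ / ρ) √(π/2) (-1)^j j`. -/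
def omg (E : p.Equilibrium) (j : ℕ) : ℝ :=
  -(E.rad * E.kap / E.dens) * √(Real.pi / 2) * (-1) ^ j * j

/-- `3 γ ρ / R`. -/
def slope (E : p.Equilibrium) : ℝ := 3 * p.adi * E.dens / E.rad

/-- The infinite matrix of the linearized system. The coordinates `0, 1, 2` are the
perturbations of the boundary density, of the radius and the velocity of the radius;
coordinate `k + 3` is the coefficient `θ_(k+1)` of the `(k+1)`-st Dirichlet eigenfunction. -/
def linMatrix (E : p.Equilibrium) : Matrix ℕ ℕ ℝ
  | 0, 2 => -E.slope
  | 0, j + 3 => E.omg (j + 1) * E.slope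
  | 1, 2 => 1
  | 2, 0 => p.gasConst * p.temp / (p.liqDensity * E.radTilde)
  | 2, 1 => (2 * p.sig * E.out ^ 4 + 2 * p.sigBar * E.rad ^ 4) /
      (p.liqDensity * E.radTilde * E.rad ^ 2 * E.out ^ 4)
  | 2, 2 => -4 * p.visc * p.volBar /
      (p.liqDensity * E.radTilde * E.rad * (E.rad ^ 3 + p.volBar))
  | k + 3, 2 => E.coeff (k + 1) * E.slope
  | k + 3, j + 3 => -E.coeff (k + 1) * E.omg (j + 1) * E.slope -
      (if k = j then E.kap * eigv (k + 1) else 0)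
  | _, _ => 0

/-- The linear operator `𝓛` on `ℓ²`. -/
def linOp (E : p.Equilibrium) : EllTwo →ₗ.[ℂ] EllTwo :=
  matrixOperator (E.linMatrix.map (fun r : ℝ => (r : ℂ)))

/-- The quadratic polynomial `ρ_l R̃ z² + (4μ_l V̄ / (R (R³ + V̄))) z - (2σ/R² + 2σ̄R²/R_out⁴)`. -/
def quad (E : p.Equilibrium) (z : ℂ) : ℂ :=
  (p.liqDensity * E.radTilde : ℝ) * z ^ 2
    + (4 * p.visc * p.volBar / (E.rad * (E.rad ^ 3 + p.volBar)) : ℝ) * z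
    - (2 * p.sig / E.rad ^ 2 + 2 * p.sigBar * E.rad ^ 2 / E.out ^ 4 : ℝ)

/-- The points `-π² κ̄ k²` (for `k ≥ 1`), at which a term of the series in `charM` is
undefined. -/
def polePt (E : p.Equilibrium) (k : ℕ) : ℂ := (-(Real.pi ^ 2 * E.kap * (k : ℝ) ^ 2) : ℝ)

/-- The function `𝕄`. The series converges absolutely at every `z` different from all the points
`-π² κ̄ k²`, `k ≥ 1`; only the values at such `z` are used. -/
def charM (E : p.Equilibrium) (z : ℂ) : ℂ :=
  (Real.pi / (p.gasConst * p.temp * p.adi) : ℝ)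
      * (4 / 3 + ∑' k : ℕ, (8 * (p.adi - 1) * E.kap : ℝ)
          / ((Real.pi ^ 2 * E.kap * ((k + 1 : ℕ) : ℝ) ^ 2 : ℝ) + z))
      * E.quad z
    + (4 * Real.pi * (E.dens / E.rad) : ℝ)

/-- The zero set of `𝕄` in its domain of definition `ℂ \ {-π² κ̄ k² : k ≥ 1}`. -/
def zerosM (E : p.Equilibrium) : Set ℂ :=
  {z | (∀ k : ℕ, 1 ≤ k → z ≠ E.polePt k) ∧ E.charM z = 0}

/-- The points `-π² κ̄ k²` (for `k ≥ 1`) that are roots of the quadratic factor of `𝕄`. -/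
def resonances (E : p.Equilibrium) : Set ℂ :=
  {z | ∃ k : ℕ, 1 ≤ k ∧ z = E.polePt k ∧ E.quad z = 0}

/-- `q = 3 R_g T_∞ ρ γ / (R (K C + A))`. -/
def qRatio (E : p.Equilibrium) : ℝ :=
  3 * p.gasConst * p.temp * E.dens * p.adi / (E.rad * (E.cK * E.cC + E.cA))

/-- `Θ₁ = 1 - √((γ - 1) / (q - 1))`. -/
def theta1 (E : p.Equilibrium) : ℝ := 1 - √((p.adi - 1) / (E.qRatio - 1))

/-- `Θ₂ = 1 - (γ - 1) / (q - 1)`. -/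
def theta2 (E : p.Equilibrium) : ℝ := 1 - (p.adi - 1) / (E.qRatio - 1)

/-- `δ = ((γ - 1) κ̄ K / (2γ)) ∑_{j ≥ 1} 1 / (π⁴ κ̄² j⁴ + K/2)`. -/
def extraDamping (E : p.Equilibrium) : ℝ :=
  (p.adi - 1) * E.kap * E.cK / (2 * p.adi) *
    ∑' j : ℕ, 1 / (Real.pi ^ 4 * E.kap ^ 2 * ((j + 1 : ℕ) : ℝ) ^ 4 + E.cK / 2)

/-- The explicit constant `ϖ`. -/
def gap (E : p.Equilibrium) : ℝ :=
  if E.cB ^ 2 ≤ 4 * E.cK * E.cC ^ 2 then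
    1 / 2 * min (E.theta2 * Real.pi ^ 2 * E.kap)
      (min (max (E.cB / (2 * E.cC)) (min (E.theta1 * Real.pi ^ 2 * E.kap) √(E.cK / 2)))
        (E.cB / (2 * E.cC) + E.extraDamping))
  else
    1 / 2 * min (E.theta2 * Real.pi ^ 2 * E.kap)
      ((E.cB - √(E.cB ^ 2 - 4 * E.cK * E.cC ^ 2)) / (2 * E.cC))

end Equilibrium

end GasLiquidParams

end

noncomputable section

/-! ### Square summable sequences -/

/-! Spectrum. The modes interact only through the scalar flux W = S (∑ ωⱼ θⱼ - z₃), so the resolvent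
equation can be solved by elimination: θ_k is -(c_k W + y_{k+3}) / (a_k + z), with a_k = π² κ̄ (k +
1)² counted from k = 0, and two scalar equations in z₁, z₂ with determinant z (N Q + G) remain. Away
from the points -a_k the operator is therefore invertible unless z = 0 or N Q + G = 0. If z = -a_m,
the m-th mode equation fixes W while θ_m becomes free and absorbs the flux equation; only Q(z) = 0
then obstructs. Explicit eigenvectors settle the converse (`Realizes.spectrum_eq`). The products c_k
ω_k do not depend on k, so N Q + G is 𝕄 up to a positive constant (`charM_eq`).

Gap. 𝕄(z) = 0 is equivalent to Q(z) (1 + (γ - 1) F(z)) = -q (K C + A), where F is an average of a_k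
/ (a_k + z) with weights 6 / (π² (k + 1)²). For Re z > -Θ₂ π² κ̄ these points, hence F, lie in the
disc (1 - Θ₂) |w|² < Re w, and this forces Re Q < -(K C + A) (`quad_re_lt`). With z = x + iy it
reads C (x² - y²) + B x + K C < 0, which controls real zeros through a discriminant. For nonreal
zeros the imaginary part of the equation expresses 2 C x + B as a negative multiple of ∑ 1 / |a_k +
z|² (`damping_identity`), so x < -B / (2C); bounding the sum from below yields the extra δ
(`re_le_of_sq_le`). The equilibrium condition enters through q > γ, which makes Θ₂ positive.

Simplicity of 0. A Jordan chain of length two would force N(0) Q(0) + G = 0, which the gap excludes.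
-/

theorem memℓp_two_iff_summable {f : ℕ → ℂ} : Memℓp f 2 ↔ Summable fun k => ‖f k‖ ^ 2 := by
  rw [memℓp_gen_iff (by norm_num)]
  simp

theorem Memℓp.summable_mul_two {f g : ℕ → ℂ} (hf : Memℓp f 2) (hg : Memℓp g 2) :
    Summable fun k => f k * g k := by
  rw [memℓp_two_iff_summable] at hf hg
  refine Summable.of_norm_bounded (hf.add hg) fun k => ?_
  rw [norm_mul]
  nlinarith [sq_nonneg (‖f k‖ - ‖g k‖), sq_nonneg (‖f k‖), sq_nonneg (‖g k‖)]

theorem memℓp_two_shift_iff {f : ℕ → ℂ} (n : ℕ) :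
    Memℓp (fun k => f (k + n)) 2 ↔ Memℓp f 2 := by
  rw [memℓp_two_iff_summable, memℓp_two_iff_summable]
  exact summable_nat_add_iff (f := fun k => ‖f k‖ ^ 2) n

theorem Memℓp.bounded_mul_two {f b : ℕ → ℂ} {K : ℝ} (hf : Memℓp f 2) (hb : ∀ k, ‖b k‖ ≤ K) :
    Memℓp (fun k => b k * f k) 2 := by
  rw [memℓp_two_iff_summable] at hf ⊢
  refine Summable.of_nonneg_of_le (fun k => by positivity) (fun k => ?_) (hf.mul_left (K ^ 2))
  rw [norm_mul, mul_pow]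
  gcongr
  exact hb k

theorem memℓp_two_ite (m : ℕ) (t : ℂ) : Memℓp (fun k => if k = m then t else 0) 2 := by
  rw [memℓp_two_iff_summable]
  refine summable_of_ne_finset_zero (s := {m}) fun k hk => ?_
  rw [if_neg (by simpa using hk)]
  simp

namespace EllTwo

theorem add_apply (x y : EllTwo) (i : ℕ) : (x + y) i = x i + y i := rfl

theorem sub_apply (x y : EllTwo) (i : ℕ) : (x - y) i = x i - y i := rfl

theorem smul_apply (c : ℂ) (x : EllTwo) (i : ℕ) : (c • x) i = c * x i := rfl

/-- The continuous coordinate functionals. -/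
def coord (i : ℕ) : EllTwo →L[ℂ] ℂ := lp.evalCLM ℂ (fun _ : ℕ => ℂ) 2 i

theorem coord_apply (i : ℕ) (x : EllTwo) : coord i x = x i := rfl

end EllTwo

/-- A family of continuous coordinate functionals whose values are always square summable is a
continuous operator (closed graph theorem). -/
theorem exists_clm_of_coord (g : ℕ → EllTwo →L[ℂ] ℂ) (h : ∀ y, Memℓp (fun i => g i y) 2) :
    ∃ T : EllTwo →L[ℂ] EllTwo, ∀ y i, (T y : EllTwo) i = g i y := by
  let T : EllTwo →ₗ[ℂ] EllTwo :=
    { toFun := fun y => ⟨fun i => g i y, h y⟩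
      map_add' := fun x y => by ext i; exact map_add (g i) x y
      map_smul' := fun c x => by ext i; exact map_smul (g i) c x }
  refine ⟨⟨T, T.continuous_of_seq_closed_graph fun u x y hu hv => ?_⟩, fun y i => rfl⟩
  ext i
  have h1 := ((EllTwo.coord i).continuous.tendsto y).comp hv
  have h2 := ((g i).continuous.tendsto x).comp hu
  exact tendsto_nhds_unique h1 h2

/-- Pairing the coordinates `n, n + 1, …` with a square summable sequence. -/
theorem exists_clm_pairing {v : ℕ → ℂ} (hv : Memℓp v 2) (n : ℕ) :
    ∃ φ : EllTwo →L[ℂ] ℂ, ∀ y : EllTwo, φ y = ∑' k, v k * y (k + n) := by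
  -- Riesz representation: the inner product is conjugate-linear in its first slot, hence the
  -- conjugate. Truncation of k - n is harmless behind the test k < n.
  have hw : Memℓp (fun k => starRingEnd ℂ (if k < n then 0 else v (k - n))) 2 := by
    rw [← memℓp_two_shift_iff n, memℓp_two_iff_summable]
    simpa using memℓp_two_iff_summable.1 hv
  let w : EllTwo := ⟨_, hw⟩
  refine ⟨innerSL ℂ w, fun y => ?_⟩
  have h := lp.hasSum_inner (𝕜 := ℂ) w y
  have h0 : ∀ i, inner ℂ (w i) (y i) = (if i < n then 0 else v (i - n)) * y i := fun i => by
    simp [w, mul_comm]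
  simp only [h0] at h
  rw [innerSL_apply_apply, ← h.tsum_eq, ← h.summable.sum_add_tsum_nat_add n,
    Finset.sum_eq_zero, zero_add]
  · simp
  · intro i hi
    simp [Finset.mem_range.1 hi]

/-! ### Operators whose action is a rank-one perturbation of a diagonal one -/

/-- The coefficients of a linear system for three scalar unknowns coupled with infinitely many
modes. -/
structure ModeSystem where
  S : ℂ
  G : ℂ
  A : ℂ
  B : ℂ
  C : ℂ
  c : ℕ → ℂ
  w : ℕ → ℂ
  a : ℕ → ℂ
  S_ne : S ≠ 0
  C_ne : C ≠ 0
  G_ne : G ≠ 0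
  c_ne : ∀ k, c k ≠ 0
  w_ne : ∀ k, w k ≠ 0
  a_inj : Function.Injective a
  c_mem : Memℓp c 2
  w_mem : ∀ z : ℂ, Memℓp (fun k => w k * (a k + z)⁻¹) 2
  bdd : ∀ z : ℂ, ∃ K : ℝ, ∀ k, ‖(a k + z)⁻¹‖ ≤ K

namespace ModeSystem

variable (M : ModeSystem)

/-- `W = S (∑ⱼ ωⱼ θⱼ - z₃)`. -/
def flux (x : ℕ → ℂ) : ℂ := M.S * (∑' k, M.w k * x (k + 3) - x 2)

/-- The image of a sequence under the system. -/
def row (x : ℕ → ℂ) : ℕ → ℂ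
  | 0 => M.flux x
  | 1 => x 2
  | 2 => (M.G * x 0 + M.A * x 1 - M.B * x 2) / M.C
  | k + 3 => -M.c k * M.flux x - M.a k * x (k + 3)

/-- `T` acts by `M.row` on its maximal domain. -/
def Realizes (T : EllTwo →ₗ.[ℂ] EllTwo) : Prop :=
  (∀ x : EllTwo, x ∈ T.domain ↔
    (Summable fun k => M.w k * x (k + 3)) ∧ Memℓp (M.row x) 2) ∧
  ∀ (x : T.domain) (i : ℕ), (T x : EllTwo) i = M.row (x : EllTwo) i

/-- Inserting x₂ = z x₁ in the velocity row of the eigenvalue equation gives G x₀ = Q(z) x₁. -/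
def Q (z : ℂ) : ℂ := M.C * z ^ 2 + M.B * z - M.A

/-- Eliminating the modes of an eigenvector off the poles turns the flux relation into N W + z x₁ =
0. At a pole the singular summand is 0 because 0⁻¹ = 0, so N there keeps only the remaining modes.
-/
def N (z : ℂ) : ℂ := 1 / M.S + ∑' k, M.c k * (M.w k * (M.a k + z)⁻¹)

/-- The mode coefficients of a solution of the resolvent equation. -/
def modes (z W t : ℂ) (m : ℕ) (f : ℕ → ℂ) (k : ℕ) : ℂ :=
  -(M.a k + z)⁻¹ * (M.c k * W + f k) + if k = m then t else 0

theorem memℓp_modes (z W t : ℂ) (m : ℕ) {f : ℕ → ℂ} (hf : Memℓp f 2) :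
    Memℓp (M.modes z W t m f) 2 := by
  obtain ⟨K, hK⟩ := M.bdd z
  have h1 : Memℓp (fun k => M.c k * W + f k) 2 := by
    have := (M.c_mem.const_smul W).add hf
    convert this using 1
    ext k
    simp [mul_comm]
  exact (h1.bounded_mul_two (b := fun k => -(M.a k + z)⁻¹) (K := K) (by simpa using hK)).add
    (memℓp_two_ite m t)

/-- The summand with t is the freedom of a resonant mode m, where a_m + z = 0; t is taken to be zero
away from the poles. -/
theorem hasSum_modes (z W t : ℂ) (m : ℕ) {f : ℕ → ℂ} (hf : Memℓp f 2) :
    HasSum (fun k => M.w k * M.modes z W t m f k)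
      (-(M.N z - 1 / M.S) * W - ∑' k, M.w k * (M.a k + z)⁻¹ * f k + M.w m * t) := by
  have h1 := ((M.c_mem.summable_mul_two (M.w_mem z)).hasSum.mul_right (-W))
  have h2 := ((M.w_mem z).summable_mul_two hf).hasSum
  have h3 : HasSum (fun k => if k = m then M.w m * t else 0) (M.w m * t) :=
    hasSum_ite_eq m _
  have h4 : (fun k => M.w k * M.modes z W t m f k) = fun k =>
      M.c k * (M.w k * (M.a k + z)⁻¹) * -W - M.w k * (M.a k + z)⁻¹ * f k +
        if k = m then M.w m * t else 0 := by
    funext k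
    simp only [modes]
    split_ifs with h
    · rw [h]; ring
    · ring
  have h5 := (h1.sub h2).add h3
  rw [← h4] at h5
  have h6 : -(M.N z - 1 / M.S) * W - ∑' k, M.w k * (M.a k + z)⁻¹ * f k + M.w m * t =
      (∑' k, M.c k * (M.w k * (M.a k + z)⁻¹)) * -W -
        ∑' k, M.w k * (M.a k + z)⁻¹ * f k + M.w m * t := by
    simp only [N]
    ring
  rw [h6]
  exact h5

variable {M} {T : EllTwo →ₗ.[ℂ] EllTwo}

/-- A nonzero eigenvector excludes a bounded inverse. -/
theorem Realizes.mem_spectrum (hT : M.Realizes T) {z : ℂ} {x : ℕ → ℂ} (hx : Memℓp x 2)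
    (hs : Summable fun k => M.w k * x (k + 3)) (he : ∀ i, M.row x i = z * x i)
    {i₀ : ℕ} (hne : x i₀ ≠ 0) : z ∈ UnboundedOp.spectrum T := by
  rintro ⟨S, -, hS⟩
  have hm : (⟨x, hx⟩ : EllTwo) ∈ T.domain := by
    refine (hT.1 _).2 ⟨hs, ?_⟩
    have : M.row x = z • x := funext he
    change Memℓp (M.row x) 2
    rw [this]
    exact hx.const_smul z
  have h0 : T ⟨⟨x, hx⟩, hm⟩ - z • (⟨x, hx⟩ : EllTwo) = 0 := by
    ext i
    rw [EllTwo.sub_apply, hT.2, EllTwo.smul_apply]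
    change M.row x i - z * x i = 0
    rw [he i, sub_self]
  have h1 := hS ⟨⟨x, hx⟩, hm⟩
  simp only [h0, map_zero] at h1
  exact hne (congrArg (fun y : EllTwo => y i₀) h1).symm

/-- A point is in the resolvent set if the resolvent equation has a solution in closed form and
the operator is injective there. -/
theorem Realizes.isResolventPoint (hT : M.Realizes T) {z : ℂ} (z0 z1 W t : EllTwo →L[ℂ] ℂ) (m : ℕ)
    (hW : ∀ y : EllTwo, W y = z * z0 y + y 0)
    (hflux : ∀ y : EllTwo, M.N z * W y + z * z1 y + y 1 +
      ∑' k, M.w k * (M.a k + z)⁻¹ * y (k + 3) = M.w m * t y)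
    (hvel : ∀ y : EllTwo, M.G * z0 y - M.Q z * z1 y = M.C * y 2 + (M.B + M.C * z) * y 1)
    (hmode : ∀ (y : EllTwo) k, M.a k + z = 0 → M.c k * W y + y (k + 3) = 0)
    (ht : ∀ y : EllTwo, (M.a m + z) * t y = 0)
    (hinj : ∀ x : EllTwo, (Summable fun k => M.w k * x (k + 3)) →
      (∀ i, M.row x i = z * x i) → x = 0) :
    UnboundedOp.IsResolventPoint T z := by
  -- The candidate inverse, coordinate by coordinate; square summability of its values already gives
  -- boundedness, by the closed graph theorem.
  let g : ℕ → EllTwo →L[ℂ] ℂ := fun i => match i with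
    | 0 => z0
    | 1 => z1
    | 2 => z • z1 + EllTwo.coord 1
    | k + 3 => (-(M.a k + z)⁻¹) • (M.c k • W + EllTwo.coord (k + 3)) + if k = m then t else 0
  have hg3 : ∀ (y : EllTwo) k,
      g (k + 3) y = M.modes z (W y) (t y) m (fun j => y (j + 3)) k := by
    intro y k
    simp only [g, modes]
    split_ifs <;> simp [EllTwo.coord_apply] <;> ring
  have hg2 : ∀ y : EllTwo, g 2 y = z * z1 y + y 1 := fun y => by simp [g, EllTwo.coord_apply]
  have hy3 : ∀ y : EllTwo, Memℓp (fun j => y (j + 3)) 2 := fun y =>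
    (memℓp_two_shift_iff (f := y) 3).2 (lp.memℓp y)
  have hmem : ∀ y, Memℓp (fun i => g i y) 2 := by
    intro y
    rw [← memℓp_two_shift_iff 3]
    simp only [hg3]
    exact M.memℓp_modes _ _ _ _ (hy3 y)
  obtain ⟨R, hR⟩ := exists_clm_of_coord g hmem
  have hsum : ∀ y : EllTwo, HasSum (fun k => M.w k * R y (k + 3))
      (W y / M.S + (z * z1 y + y 1)) := by
    intro y
    simp only [hR, hg3]
    convert M.hasSum_modes z (W y) (t y) m (hy3 y) using 1
    linear_combination hflux y
  have hfl : ∀ y : EllTwo, M.flux (R y) = W y := by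
    intro y
    have hS := M.S_ne
    rw [flux, (hsum y).tsum_eq, hR, hg2]
    field_simp
    ring
  have hrow : ∀ (y : EllTwo) i, M.row (R y) i = y i + z * R y i := by
    intro y i
    match i with
    | 0 =>
      simp only [row, hfl, hR, hW, g]
      ring
    | 1 =>
      simp only [row, hR, hg2, g]
      ring
    | 2 =>
      have hC := M.C_ne
      simp only [row, hR, hg2]
      rw [div_eq_iff hC]
      have := hvel y
      simp only [Q] at this
      simp only [g]
      linear_combination this
    | k + 3 =>
      simp only [row, hfl, hR, hg3, modes]
      -- At a pole the inverse is 0, so W drops out of the k-th coefficient and the equation becomes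
      -- the compatibility condition `hmode`.
      by_cases h : M.a k + z = 0
      · have h2 := hmode y k h
        simp only [h, inv_zero]
        linear_combination -h2 - (if k = m then t y else 0) * h
      · have h3 : (M.a k + z) * (if k = m then t y else 0) = 0 := by
          split_ifs with hk
          · rw [hk, ht]
          · simp
        linear_combination -h3 + (M.c k * W y + y (k + 3)) * (mul_inv_cancel₀ h)
  have hdom : ∀ y, R y ∈ T.domain := by
    intro y
    refine (hT.1 _).2 ⟨(hsum y).summable, ?_⟩
    have : M.row (R y) = ⇑(y + z • R y) := by
      ext i
      rw [hrow, EllTwo.add_apply, EllTwo.smul_apply]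
    rw [this]
    exact lp.memℓp _
  have hTR : ∀ y, T ⟨R y, hdom y⟩ - z • R y = y := by
    intro y
    ext i
    rw [EllTwo.sub_apply, hT.2, EllTwo.smul_apply, hrow, add_sub_cancel_right]
  refine ⟨R, fun y => ⟨hdom y, hTR y⟩, fun x => ?_⟩
  set y := T x - z • (x : EllTwo) with hy
  -- The right inverse is also a left inverse: R (T - z) x - x is killed by T - z, and `hinj`
  -- applies.
  have hd : (⟨R y, hdom y⟩ - x : T.domain) = 0 := by
    have hz : T (⟨R y, hdom y⟩ - x) = z • ((⟨R y, hdom y⟩ - x : T.domain) : EllTwo) := by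
      have := hTR y
      rw [LinearPMap.map_sub, Submodule.coe_sub, smul_sub, sub_eq_iff_eq_add]
      rw [sub_eq_iff_eq_add] at this
      rw [this, hy]
      abel
    refine Subtype.ext (hinj _ ((hT.1 _).1 (Subtype.mem _)).1 fun i => ?_)
    rw [← hT.2, hz, EllTwo.smul_apply]
  have := congrArg Subtype.val (sub_eq_zero.1 hd)
  exact this

end ModeSystem

end

noncomputable section

/-! ### Eigenvectors and the resolvent in closed form -/

namespace ModeSystem

variable {M : ModeSystem} {T : EllTwo →ₗ.[ℂ] EllTwo}

theorem hasSum_modes_zero (M : ModeSystem) (z W t : ℂ) (m : ℕ) :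
    HasSum (fun k => M.w k * M.modes z W t m 0 k)
      (-(M.N z - 1 / M.S) * W + M.w m * t) := by
  convert M.hasSum_modes z W t m zero_memℓp using 1
  simp

/-- The sequence with three given scalar entries and given modes. -/
def assemble (x0 x1 x2 : ℂ) (f : ℕ → ℂ) : ℕ → ℂ
  | 0 => x0
  | 1 => x1
  | 2 => x2
  | k + 3 => f k

theorem memℓp_assemble (x0 x1 x2 : ℂ) {f : ℕ → ℂ} (hf : Memℓp f 2) :
    Memℓp (assemble x0 x1 x2 f) 2 :=
  (memℓp_two_shift_iff 3).1 hf

/-- Eigenvectors in closed form. -/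
theorem Realizes.mem_spectrum_of_modes (hT : M.Realizes T) {z x0 x1 t : ℂ} (m : ℕ) (i₀ : ℕ)
    (hne : assemble x0 x1 (z * x1) (M.modes z (z * x0) t m 0) i₀ ≠ 0)
    (hflux : M.N z * (z * x0) + z * x1 = M.w m * t)
    (hvel : M.G * x0 - M.Q z * x1 = 0)
    (hmode : ∀ k, M.a k + z = 0 → z * x0 = 0)
    (ht : (M.a m + z) * t = 0) : z ∈ UnboundedOp.spectrum T := by
  have hs := M.hasSum_modes_zero z (z * x0) t m
  have hfl : M.flux (assemble x0 x1 (z * x1) (M.modes z (z * x0) t m 0)) = z * x0 := by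
    have hS := M.S_ne
    simp only [flux, assemble]
    rw [hs.tsum_eq]
    have : z * x0 = M.S * (z * x0 / M.S) := by field_simp
    rw [this]
    simp only [← hflux]
    field_simp
    ring
  refine hT.mem_spectrum (memℓp_assemble _ _ _ (M.memℓp_modes z (z * x0) t m zero_memℓp))
    hs.summable (fun i => ?_) hne
  match i with
  | 0 => simp only [row, hfl, assemble]
  | 1 => simp only [row, assemble]
  | 2 =>
    simp only [row, assemble]
    rw [div_eq_iff M.C_ne]
    simp only [Q] at hvel
    linear_combination hvel
  | k + 3 =>
    simp only [row, hfl]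
    simp only [assemble, modes, Pi.zero_apply, add_zero]
    by_cases h : M.a k + z = 0
    · rw [hmode k h]
      simp only [h, inv_zero]
      linear_combination -(if k = m then t else 0) * h
    · have h3 : (M.a k + z) * (if k = m then t else 0) = 0 := by
        split_ifs with hk
        · rw [hk, ht]
        · simp
      linear_combination -h3 + (M.c k * (z * x0)) * (mul_inv_cancel₀ h)

/-- A state at rest with G x₀ + A x₁ = 0 and no modes has zero flux and balances the velocity row.
-/
theorem Realizes.zero_mem_spectrum (hT : M.Realizes T) : (0 : ℂ) ∈ UnboundedOp.spectrum T :=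
  hT.mem_spectrum_of_modes (x0 := M.A) (x1 := -M.G) (t := 0) 0 1
    (by simpa [assemble] using M.G_ne) (by simp) (by simp only [Q]; ring) (by simp) (by simp)

/-- The choice x₀ = 1, x₁ = -N satisfies the flux relation, and the velocity relation is then the
determinant condition. -/
theorem Realizes.mem_spectrum_of_root (hT : M.Realizes T) {z : ℂ}
    (hz : ∀ k, M.a k + z ≠ 0) (hd : M.N z * M.Q z + M.G = 0) : z ∈ UnboundedOp.spectrum T :=
  hT.mem_spectrum_of_modes (x0 := 1) (x1 := -M.N z) (t := 0) 0 0
    (by simp [assemble]) (by ring) (by linear_combination hd) (fun k hk => absurd hk (hz k))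
    (by simp)

/-- With x₀ = 0 the flux vanishes, and Q = 0 leaves x₁ free. The resonant mode compensates the
velocity through ω_m t = z x₁. -/
theorem Realizes.mem_spectrum_of_resonance (hT : M.Realizes T) {z : ℂ} {m : ℕ}
    (hm : M.a m + z = 0) (hQ : M.Q z = 0) : z ∈ UnboundedOp.spectrum T :=
  hT.mem_spectrum_of_modes (x0 := 0) (x1 := 1) (t := z / M.w m) m 1
    (by simp [assemble]) (by have := M.w_ne m; field_simp; ring) (by simp [hQ]) (by simp)
    (by simp [hm])

/-- The relations between the entries of an eigenvector. -/
theorem eigen_relations {z : ℂ} {x : ℕ → ℂ} (he : ∀ i, M.row x i = z * x i) :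
    M.flux x = z * x 0 ∧ x 2 = z * x 1 ∧ M.G * x 0 - M.Q z * x 1 = 0 ∧
      ∀ k, (M.a k + z) * x (k + 3) = -M.c k * M.flux x := by
  have h0 := he 0
  have h1 := he 1
  have h2 := he 2
  simp only [row] at h0 h1 h2
  rw [div_eq_iff M.C_ne] at h2
  refine ⟨h0, h1, ?_, fun k => ?_⟩
  · simp only [Q]
    linear_combination h2 + (M.B + M.C * z) * h1
  · have h3 := he (k + 3)
    simp only [row] at h3
    linear_combination -h3

theorem tsum_of_nonpole {z W : ℂ} {x : ℕ → ℂ} (hz : ∀ k, M.a k + z ≠ 0)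
    (h3 : ∀ k, (M.a k + z) * x (k + 3) = -M.c k * W) :
    ∑' k, M.w k * x (k + 3) = -(M.N z - 1 / M.S) * W := by
  have h4 : ∀ k, x (k + 3) = M.modes z W 0 0 0 k := by
    intro k
    have := hz k
    simp only [modes, ite_self, Pi.zero_apply, add_zero]
    field_simp
    linear_combination h3 k
  simp only [h4]
  rw [(M.hasSum_modes_zero z W 0 0).tsum_eq]
  ring

/-- Cramer's rule for N x₀ + x₁ = h₁ / z and G x₀ - Q x₁ = h₂, whose elimination gives (N Q + G) x₀
= Q h₁ / z + h₂. -/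
theorem Realizes.isResolventPoint_of_nonpole (hT : M.Realizes T) {z : ℂ} (h0 : z ≠ 0)
    (hz : ∀ k, M.a k + z ≠ 0) (hd : M.N z * M.Q z + M.G ≠ 0) :
    UnboundedOp.IsResolventPoint T z := by
  obtain ⟨σ, hσ⟩ := exists_clm_pairing (M.w_mem z) 3
  let h1 : EllTwo →L[ℂ] ℂ := -σ - EllTwo.coord 1 - M.N z • EllTwo.coord 0
  let h2 : EllTwo →L[ℂ] ℂ := M.C • EllTwo.coord 2 + (M.B + M.C * z) • EllTwo.coord 1
  let z0 : EllTwo →L[ℂ] ℂ := (M.N z * M.Q z + M.G)⁻¹ • ((M.Q z / z) • h1 + h2)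
  refine hT.isResolventPoint z0 (z⁻¹ • h1 - M.N z • z0) (z • z0 + EllTwo.coord 0) 0 0
    (fun y => by simp [EllTwo.coord_apply]) (fun y => ?_) (fun y => ?_)
    (fun y k hk => absurd hk (hz k)) (by simp) fun x hx he => ?_
  · rw [← hσ]
    simp only [add_apply, sub_apply,
      smul_apply, EllTwo.coord_apply, smul_eq_mul,
      zero_apply, mul_zero, h1, neg_apply]
    field_simp
    ring
  · have e0 : (M.N z * M.Q z + M.G) * z0 y = M.Q z / z * h1 y + h2 y := by
      simp only [z0, add_apply, smul_apply, smul_eq_mul]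
      exact mul_inv_cancel_left₀ hd _
    have e2 : h2 y = M.C * y 2 + (M.B + M.C * z) * y 1 := rfl
    rw [← e2]
    simp only [sub_apply, smul_apply, smul_eq_mul]
    linear_combination e0
  · obtain ⟨r0, r2, r1, r3⟩ := eigen_relations he
    have hs := tsum_of_nonpole hz r3
    have hS := M.S_ne
    have hfl : M.flux x = M.S * (-(M.N z - 1 / M.S) * (z * x 0) - z * x 1) := by
      rw [flux, hs, r0, r2]
    have e1 : M.N z * x 0 + x 1 = 0 := by
      have : M.S * z * (M.N z * x 0 + x 1) = 0 := by
        rw [r0] at hfl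
        field_simp at hfl
        linear_combination z * hfl
      simpa [hS, h0] using this
    have e0 : x 0 = 0 := by
      have : (M.N z * M.Q z + M.G) * x 0 = 0 := by linear_combination r1 + M.Q z * e1
      simpa [hd] using this
    have e1' : x 1 = 0 := by simpa [e0] using e1
    ext i
    match i with
    | 0 => exact e0
    | 1 => exact e1'
    | 2 => rw [r2, e1', mul_zero]; rfl
    | k + 3 =>
      have := r3 k
      rw [r0, e0] at this
      simpa [hz k] using this

/-- The system is now triangular: mode m gives W, the density row x₀, the velocity row x₁ since Q ≠
0, and the flux relation the free entry t since ω_m ≠ 0. -/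
theorem Realizes.isResolventPoint_of_pole (hT : M.Realizes T) {z : ℂ} (h0 : z ≠ 0) {m : ℕ}
    (hm : M.a m + z = 0) (hQ : M.Q z ≠ 0) : UnboundedOp.IsResolventPoint T z := by
  have huniq : ∀ k, M.a k + z = 0 → k = m := fun k hk =>
    M.a_inj (by linear_combination hk - hm)
  have hc := M.c_ne m
  have hw := M.w_ne m
  obtain ⟨σ, hσ⟩ := exists_clm_pairing (M.w_mem z) 3
  let W : EllTwo →L[ℂ] ℂ := (-(M.c m)⁻¹) • EllTwo.coord (m + 3)
  let z0 : EllTwo →L[ℂ] ℂ := z⁻¹ • (W - EllTwo.coord 0)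
  let z1 : EllTwo →L[ℂ] ℂ :=
    (M.Q z)⁻¹ • (M.G • z0 - M.C • EllTwo.coord 2 - (M.B + M.C * z) • EllTwo.coord 1)
  let t : EllTwo →L[ℂ] ℂ := (M.w m)⁻¹ • (M.N z • W + z • z1 + EllTwo.coord 1 + σ)
  refine hT.isResolventPoint z0 z1 W t m (fun y => ?_) (fun y => ?_) (fun y => ?_)
    (fun y k hk => ?_) (fun y => by rw [hm, zero_mul]) fun x hx he => ?_
  · simp only [z0, smul_apply, sub_apply,
      EllTwo.coord_apply, smul_eq_mul]
    field_simp
    ring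
  · rw [← hσ]
    simp only [t, smul_apply, add_apply,
      EllTwo.coord_apply, smul_eq_mul]
    field_simp
  · simp only [z1, smul_apply, sub_apply,
      EllTwo.coord_apply, smul_eq_mul]
    field_simp
    ring
  · rw [huniq k hk]
    simp only [W, smul_apply, EllTwo.coord_apply, smul_eq_mul]
    field_simp
    ring
  · obtain ⟨r0, r2, r1, r3⟩ := eigen_relations he
    have hfl : M.flux x = 0 := by
      have := r3 m
      rw [hm, zero_mul] at this
      simpa [hc] using this.symm
    have e0 : x 0 = 0 := by simpa [hfl, h0] using r0
    have e1 : x 1 = 0 := by simpa [e0, hQ] using r1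
    have e2 : x 2 = 0 := by rw [r2, e1, mul_zero]
    have e3 : ∀ k, k ≠ m → x (k + 3) = 0 := by
      intro k hk
      have := r3 k
      rw [hfl, mul_zero] at this
      exact (mul_eq_zero.1 this).resolve_left fun h => hk (huniq k h)
    have em : x (m + 3) = 0 := by
      rw [flux, e2, sub_zero, tsum_eq_single m (fun k hk => by rw [e3 k hk, mul_zero])] at hfl
      simpa [M.S_ne, hw] using hfl
    ext i
    match i with
    | 0 => exact e0
    | 1 => exact e1
    | 2 => exact e2
    | k + 3 =>
      by_cases hk : k = m
      · rw [hk]; exact em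
      · exact e3 k hk

/-- The spectrum of a mode system. -/
theorem Realizes.spectrum_eq (hT : M.Realizes T) :
    UnboundedOp.spectrum T =
      {0} ∪ {z | (∀ k, M.a k + z ≠ 0) ∧ M.N z * M.Q z + M.G = 0} ∪
        {z | ∃ m, M.a m + z = 0 ∧ M.Q z = 0} := by
  ext z
  constructor
  · intro hz
    by_contra hn
    simp only [Set.mem_union, Set.mem_singleton_iff, Set.mem_ofPred_eq, not_or, not_and,
      not_exists] at hn
    obtain ⟨⟨h0, h1⟩, h2⟩ := hn
    by_cases hp : ∀ k, M.a k + z ≠ 0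
    · exact hz (hT.isResolventPoint_of_nonpole h0 hp (h1 hp))
    · push Not at hp
      obtain ⟨m, hm⟩ := hp
      exact hz (hT.isResolventPoint_of_pole h0 hm (h2 m hm))
  · rintro ((rfl | ⟨h1, h2⟩) | ⟨m, h1, h2⟩)
    · exact hT.zero_mem_spectrum
    · exact hT.mem_spectrum_of_root h1 h2
    · exact hT.mem_spectrum_of_resonance h1 h2

/-! ### The generalized kernel -/

theorem mem_genKer_succ {T : EllTwo →ₗ.[ℂ] EllTwo} {n : ℕ} {x : EllTwo} :
    x ∈ UnboundedOp.genKer T 0 (n + 1) ↔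
      ∃ h : x ∈ T.domain, T ⟨x, h⟩ ∈ UnboundedOp.genKer T 0 n := by
  rw [UnboundedOp.genKer, Submodule.mem_map]
  constructor
  · rintro ⟨y, hy, rfl⟩
    refine ⟨y.2, ?_⟩
    simpa using hy
  · rintro ⟨h, hx⟩
    exact ⟨⟨x, h⟩, by simpa using hx, rfl⟩

/-- A vector spanning the kernel. -/
def kerVec (M : ModeSystem) : EllTwo :=
  ⟨assemble M.A (-M.G) 0 0, memℓp_assemble _ _ _ zero_memℓp⟩

theorem kerVec_ne_zero : M.kerVec ≠ 0 := by
  intro h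
  have := congrArg (fun y : EllTwo => y 1) h
  exact M.G_ne (neg_eq_zero.1 this)

theorem Realizes.apply_kerVec (hT : M.Realizes T) :
    ∃ h : M.kerVec ∈ T.domain, T ⟨M.kerVec, h⟩ = 0 := by
  have hr : ∀ i, M.row M.kerVec i = 0 := by
    have hf : M.flux M.kerVec = 0 := by simp [flux, kerVec, assemble]
    intro i
    match i with
    | 0 => simp only [row, hf]
    | 1 => simp only [row, kerVec, assemble]
    | 2 => simp only [row, kerVec, assemble]; ring
    | k + 3 =>
      simp only [row, hf]
      simp [kerVec, assemble]
  have hd : M.kerVec ∈ T.domain := by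
    refine (hT.1 _).2 ⟨?_, ?_⟩
    · simp [kerVec, assemble]
    · rw [show M.row M.kerVec = 0 from funext hr]
      exact zero_memℓp
  refine ⟨hd, ?_⟩
  ext i
  rw [hT.2]
  exact hr i

/-- If `T x` is `t` times the kernel vector, then `t = 0` and `x` is in the span of the kernel
vector. -/
theorem Realizes.generalized_kernel (hT : M.Realizes T) (ha : ∀ k, M.a k ≠ 0)
    (hd : M.N 0 * M.Q 0 + M.G ≠ 0) (x : T.domain) (t : ℂ) (hx : T x = t • M.kerVec) :
    t = 0 ∧ ∃ s : ℂ, s • M.kerVec = x := by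
  have hrow : ∀ i, M.row (x : EllTwo) i = t * M.kerVec i := by
    intro i
    rw [← hT.2, hx, EllTwo.smul_apply]
  have h0 := hrow 0
  have h1 := hrow 1
  have h2 := hrow 2
  have h3 : ∀ k, -M.c k * M.flux (x : EllTwo) - M.a k * (x : EllTwo) (k + 3) = t * 0 :=
    fun k => hrow (k + 3)
  simp only [row, kerVec, assemble] at h0 h1 h2
  rw [div_eq_iff M.C_ne] at h2
  have hS := M.S_ne
  have hs := tsum_of_nonpole (M := M) (z := 0) (W := M.flux (x : EllTwo)) (x := (x : EllTwo))
    (by simpa using ha) (fun k => by linear_combination -h3 k)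
  -- The flux equals t A by the density row; computed from the modes and x₂ = -t G it gives a second
  -- value. As Q(0) = -A, their difference is a multiple of t (N Q + G).
  have ht : t = 0 := by
    have hf : M.flux (x : EllTwo) = M.flux (x : EllTwo) := rfl
    conv_rhs at hf => rw [flux, hs]
    rw [h0, h1] at hf
    field_simp at hf
    have : t * (M.N 0 * M.Q 0 + M.G) = 0 := by
      have : M.S * (t * (M.N 0 * M.Q 0 + M.G)) = 0 := by
        simp only [Q]
        linear_combination -hf
      simpa [hS] using this
    simpa [hd] using this
  subst ht
  rw [zero_mul] at h0 h1 h2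
  have hG := M.G_ne
  refine ⟨rfl, -(x : EllTwo) 1 / M.G, ?_⟩
  ext i
  rw [EllTwo.smul_apply]
  match i with
  | 0 =>
    simp only [kerVec, assemble]
    field_simp
    linear_combination -h2 - M.B * h1
  | 1 =>
    simp only [kerVec, assemble]
    field_simp
  | 2 => simp only [kerVec, assemble, h1, mul_zero]
  | k + 3 =>
    have := h3 k
    rw [h0] at this
    have h4 : (x : EllTwo) (k + 3) = 0 := by simpa [ha k] using this
    simp only [kerVec, assemble, h4, Pi.zero_apply, mul_zero]

/-- The kernel vector is not in the range, so the chain of kernels stops at its first step. -/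
theorem Realizes.genKer_succ_eq (hT : M.Realizes T) (ha : ∀ k, M.a k ≠ 0)
    (hd : M.N 0 * M.Q 0 + M.G ≠ 0) (n : ℕ) :
    UnboundedOp.genKer T 0 (n + 1) = Submodule.span ℂ {M.kerVec} := by
  obtain ⟨hk, hk0⟩ := hT.apply_kerVec
  induction n with
  | zero =>
    ext x
    rw [mem_genKer_succ, Submodule.mem_span_singleton]
    constructor
    · rintro ⟨h, hx⟩
      rw [UnboundedOp.genKer, Submodule.mem_bot] at hx
      exact (hT.generalized_kernel ha hd ⟨x, h⟩ 0 (by rw [hx, zero_smul])).2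
    · rintro ⟨s, rfl⟩
      refine ⟨T.domain.smul_mem s hk, ?_⟩
      have := T.map_smul s ⟨_, hk⟩
      rw [hk0, smul_zero] at this
      rw [UnboundedOp.genKer, Submodule.mem_bot]
      exact this
  | succ n ih =>
    ext x
    rw [mem_genKer_succ, ih, Submodule.mem_span_singleton]
    simp only [Submodule.mem_span_singleton]
    constructor
    · rintro ⟨h, s, hs⟩
      exact (hT.generalized_kernel ha hd ⟨x, h⟩ s hs.symm).2
    · rintro ⟨s, rfl⟩
      refine ⟨T.domain.smul_mem s hk, 0, ?_⟩
      have := T.map_smul s ⟨_, hk⟩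
      rw [hk0, smul_zero] at this
      rw [zero_smul]
      exact this.symm

theorem Realizes.finrank_eigenspace (hT : M.Realizes T) (ha : ∀ k, M.a k ≠ 0)
    (hd : M.N 0 * M.Q 0 + M.G ≠ 0) :
    Module.finrank ℂ (UnboundedOp.eigenspace T 0) = 1 := by
  rw [UnboundedOp.eigenspace, hT.genKer_succ_eq ha hd 0]
  exact finrank_span_singleton kerVec_ne_zero

theorem Realizes.finrank_genEigenspace (hT : M.Realizes T) (ha : ∀ k, M.a k ≠ 0)
    (hd : M.N 0 * M.Q 0 + M.G ≠ 0) :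
    Module.finrank ℂ (UnboundedOp.genEigenspace T 0) = 1 := by
  have : UnboundedOp.genEigenspace T 0 = Submodule.span ℂ {M.kerVec} := by
    apply le_antisymm
    · refine iSup_le fun n => ?_
      cases n with
      | zero => exact bot_le
      | succ n => exact (hT.genKer_succ_eq ha hd n).le
    · rw [← hT.genKer_succ_eq ha hd 0]
      exact le_iSup (UnboundedOp.genKer T 0) 1
  rw [this]
  exact finrank_span_singleton kerVec_ne_zero

end ModeSystem

end

noncomputable section

theorem HasSum.of_eq {R : Type*} [AddCommMonoid R] [TopologicalSpace R] {f g : ℕ → R} {a b : R}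
    (h : HasSum g b) (hf : ∀ k, f k = g k)
    (ha : a = b) : HasSum f a := by
  rw [ha, show f = g from funext hf]
  exact h

/-! ### Estimates for the diagonal coefficients -/

/-- The sequence `α (k + 1) ^ 2`. -/
def quadSeq (α : ℝ) (k : ℕ) : ℝ := α * ((k + 1 : ℕ) : ℝ) ^ 2

theorem quadSeq_pos {α : ℝ} (hα : 0 < α) (k : ℕ) : 0 < quadSeq α k := by
  unfold quadSeq
  positivity

theorem le_quadSeq {α : ℝ} (hα : 0 < α) (k : ℕ) : α ≤ quadSeq α k := by
  have : (1 : ℝ) ≤ ((k + 1 : ℕ) : ℝ) := by exact_mod_cast Nat.succ_pos k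
  unfold quadSeq
  nlinarith [mul_pos hα (by linarith : (0 : ℝ) < ((k + 1 : ℕ) : ℝ))]

theorem quadSeq_injective {α : ℝ} (hα : 0 < α) : Function.Injective (quadSeq α) := by
  intro j k h
  have h1 := mul_left_cancel₀ hα.ne' h
  have h2 := (pow_left_inj₀ (by positivity) (by positivity) two_ne_zero).1 h1
  exact Nat.succ_injective (by exact_mod_cast h2)

theorem summable_inv_succ_sq : Summable fun k : ℕ => 1 / (((k + 1 : ℕ) : ℝ) ^ 2) :=
  (summable_nat_add_iff 1).2 (Real.summable_one_div_nat_pow.2 one_lt_two)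

theorem summable_inv_quadSeq (α : ℝ) : Summable fun k : ℕ => 1 / quadSeq α k := by
  refine (summable_congr fun k => ?_).2 (summable_inv_succ_sq.mul_left (1 / α))
  rw [one_div_mul_one_div]
  rfl

/-- Multiplied by (k + 1)², the inverses converge to 1/α and are therefore bounded. Poles need no
exception since 0⁻¹ = 0. -/
theorem exists_bound_inv_quadSeq {α : ℝ} (hα : 0 < α) (z : ℂ) :
    ∃ K : ℝ, ∀ k, ‖((quadSeq α k : ℝ) + z)⁻¹‖ ≤ K * (1 / (((k + 1 : ℕ) : ℝ) ^ 2)) := by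
  have h0 : Filter.Tendsto (fun k : ℕ => 1 / (((k + 1 : ℕ) : ℂ) ^ 2)) Filter.atTop (nhds 0) := by
    have h := summable_inv_succ_sq.tendsto_atTop_zero
    have := (Complex.continuous_ofReal.tendsto 0).comp h
    simpa [Function.comp_def] using this
  have h1 : Filter.Tendsto (fun k : ℕ => ((α : ℂ) + z * (1 / (((k + 1 : ℕ) : ℂ) ^ 2)))⁻¹)
      Filter.atTop (nhds ((α : ℂ) + z * 0)⁻¹) :=
    (tendsto_const_nhds.add (h0.const_mul z)).inv₀ (by simpa using hα.ne')
  obtain ⟨K, hK⟩ := (Metric.isBounded_range_of_tendsto _ h1).exists_norm_le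
  refine ⟨K, fun k => ?_⟩
  have h2 := hK _ (Set.mem_range_self k)
  have hk : ((k + 1 : ℕ) : ℂ) ≠ 0 := by exact_mod_cast Nat.succ_ne_zero k
  have h3 : ((quadSeq α k : ℝ) + z)⁻¹ =
      ((α : ℂ) + z * (1 / (((k + 1 : ℕ) : ℂ) ^ 2)))⁻¹ * (1 / (((k + 1 : ℕ) : ℂ) ^ 2)) := by
    rw [one_div, ← mul_inv, quadSeq]
    congr 1
    push_cast
    field_simp
  have h4 : ‖1 / (((k + 1 : ℕ) : ℂ) ^ 2)‖ = 1 / (((k + 1 : ℕ) : ℝ) ^ 2) := by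
    rw [norm_div, norm_pow, Complex.norm_natCast, norm_one]
  rw [h3, norm_mul, h4]
  exact mul_le_mul_of_nonneg_right h2 (by positivity)

theorem summable_inv_quadSeq_add {α : ℝ} (hα : 0 < α) (z : ℂ) :
    Summable fun k => ((quadSeq α k : ℝ) + z)⁻¹ := by
  obtain ⟨K, hK⟩ := exists_bound_inv_quadSeq hα z
  exact Summable.of_norm_bounded (summable_inv_succ_sq.mul_left K) hK

/-! ### Elementary properties of the physical constants -/

namespace GasLiquidParams

variable (p : GasLiquidParams)

theorem one_lt_adi : 1 < p.adi := by
  have := div_pos p.gasConst_pos p.heatCap_pos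
  unfold adi
  linarith

theorem volBar_pos : 0 < p.volBar := by
  have := p.vol_pos
  have := Real.pi_pos
  unfold volBar
  positivity

namespace Equilibrium

variable {p} (E : p.Equilibrium)

theorem out_cube : E.out ^ 3 = E.rad ^ 3 + p.volBar := by
  have h1 := E.rad_pos
  have h2 := p.volBar_pos
  unfold out outer
  rw [← Real.rpow_natCast, ← Real.rpow_mul (by positivity)]
  norm_num

theorem out_pos : 0 < E.out := by
  have h1 := E.rad_pos
  have h2 := p.volBar_pos
  unfold out outer
  positivity

theorem rad_lt_out : E.rad < E.out := by
  refine lt_of_pow_lt_pow_left₀ 3 E.out_pos.le ?_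
  rw [E.out_cube]
  linarith [p.volBar_pos]

theorem radTilde_eq : E.radTilde = E.rad * (E.out - E.rad) / E.out := by
  have := E.out_pos
  unfold radTilde
  field_simp

theorem radTilde_pos : 0 < E.radTilde := by
  rw [E.radTilde_eq]
  exact div_pos (mul_pos E.rad_pos (sub_pos.2 E.rad_lt_out)) E.out_pos

theorem kap_pos : 0 < E.kap := by
  have h1 := E.rad_pos
  have h2 := E.dens_pos
  have h3 := p.one_lt_adi
  have h4 := p.heatCap_pos
  have h5 := p.thermal_pos
  unfold kap
  positivity

theorem cA_pos : 0 < E.cA := by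
  have h1 := E.rad_pos
  have h2 := E.out_pos
  have h3 := p.sig_pos
  have h4 := p.sigBar_pos
  unfold cA
  positivity

theorem cB_pos : 0 < E.cB := by
  have h1 := E.rad_pos
  have h2 := p.volBar_pos
  have h3 := p.visc_pos
  unfold cB
  positivity

theorem cC_pos : 0 < E.cC := mul_pos p.liqDensity_pos E.radTilde_pos

theorem slope_pos : 0 < E.slope := by
  have h1 := E.rad_pos
  have h2 := E.dens_pos
  have h3 := p.one_lt_adi
  unfold slope
  positivity

theorem cK_mul_cC : E.cK * E.cC = 2 * (p.gasConst * p.temp) * E.dens / E.rad := by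
  have h1 := E.rad_pos
  have h2 := E.out_pos
  have h3 := sub_pos.2 E.rad_lt_out
  have h4 := p.liqDensity_pos
  rw [cK, cC, E.radTilde_eq]
  field_simp

theorem gas_pos : 0 < p.gasConst * p.temp := mul_pos p.gasConst_pos p.temp_pos

theorem cK_pos : 0 < E.cK := by
  have h : 0 < E.cK * E.cC := by
    rw [E.cK_mul_cC]
    have h1 := E.rad_pos
    have h2 := E.dens_pos
    have h3 := gas_pos (p := p)
    positivity
  exact pos_of_mul_pos_left h E.cC_pos.le

/-- The equilibrium condition makes the gas pressure dominate the surface tension terms. -/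
theorem cA_mul_rad_lt : E.cA * E.rad < p.gasConst * p.temp * E.dens := by
  have h1 := E.rad_pos
  have h2 := E.out_pos
  have h3 := E.rad_lt_out
  have h4 := gas_pos (p := p)
  have h5 := p.sigBar_pos
  have hb := E.balance
  change E.dens = 2 / (p.gasConst * p.temp) * (p.sig / E.rad + p.sigBar / E.out) at hb
  have e1 : p.gasConst * p.temp * E.dens = 2 * p.sig / E.rad + 2 * p.sigBar / E.out := by
    have h6 := p.gasConst_pos
    have h7 := p.temp_pos
    rw [hb]
    field_simp
  have e2 : E.cA * E.rad = 2 * p.sig / E.rad + 2 * p.sigBar / E.out * (E.rad / E.out) ^ 3 := by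
    unfold cA
    field_simp
  rw [e1, e2]
  have h6 : (E.rad / E.out) ^ 3 < 1 :=
    pow_lt_one₀ (by positivity) ((div_lt_one h2).2 h3) three_ne_zero
  have h7 : 0 < 2 * p.sigBar / E.out := by positivity
  nlinarith

/-- With P = R_g T_∞ ρ, R (K C + A) = 2P + A R < 3P, while q R (K C + A) = 3Pγ. -/
theorem adi_lt_qRatio : p.adi < E.qRatio := by
  have h0 := p.one_lt_adi
  have h1 := E.rad_pos
  have h2 := E.cA_pos
  have h3 := mul_pos E.cK_pos E.cC_pos
  have h4 := E.cA_mul_rad_lt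
  have h5 : E.rad * (E.cK * E.cC) = 2 * (p.gasConst * p.temp) * E.dens := by
    rw [E.cK_mul_cC]
    field_simp
  rw [qRatio, lt_div_iff₀ (by positivity), mul_add, h5]
  nlinarith

/-- `π² κ̄`. -/
def rate : ℝ := Real.pi ^ 2 * E.kap

theorem rate_pos : 0 < E.rate := mul_pos (by positivity) E.kap_pos

/-! ### The bubble operator as a mode system -/

theorem coeff_succ (k : ℕ) : E.coeff (k + 1) =
    ((2 : ℝ) ^ (3 / 2 : ℝ) * (p.adi - 1) / (√Real.pi * p.adi)) * ((-1) ^ k / ((k + 1 : ℕ) : ℝ)) := by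
  unfold coeff
  rw [Nat.add_sub_cancel]
  ring

theorem omg_succ (k : ℕ) : E.omg (k + 1) =
    (E.rad * E.kap / E.dens * √(Real.pi / 2)) * ((-1) ^ k * ((k + 1 : ℕ) : ℝ)) := by
  unfold omg
  ring

/-- The signs and the factors k + 1 cancel, so N involves the modes only through ∑ 1 / (a_k + z). -/
theorem coeff_mul_omg (k : ℕ) : E.coeff (k + 1) * E.omg (k + 1) =
    2 * (p.adi - 1) * E.rad * E.kap / (E.dens * p.adi) := by
  have h0 := p.one_lt_adi
  have h1 := E.dens_pos
  have hk : ((k + 1 : ℕ) : ℝ) ≠ 0 := by exact_mod_cast Nat.succ_ne_zero k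
  have h2 : (2 : ℝ) ^ (3 / 2 : ℝ) = 2 * √2 := by
    rw [show (3 / 2 : ℝ) = 1 + 1 / 2 by norm_num, Real.rpow_add two_pos, Real.rpow_one,
      Real.sqrt_eq_rpow]
  have h3 : √(Real.pi / 2) = √Real.pi / √2 := Real.sqrt_div Real.pi_pos.le 2
  have h4 : √Real.pi ≠ 0 := (Real.sqrt_pos.2 Real.pi_pos).ne'
  have h5 : ((-1 : ℝ) ^ k) * (-1) ^ k = 1 := by rw [← mul_pow]; norm_num
  rw [E.coeff_succ, E.omg_succ, h2, h3]
  field_simp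
  linear_combination (p.adi - 1) * E.rad * E.kap * h5

theorem coeff_ne_zero (k : ℕ) : E.coeff (k + 1) ≠ 0 := by
  have h := E.coeff_mul_omg k
  intro h0
  have h1 := p.one_lt_adi
  have h2 := E.kap_pos
  have h3 := E.rad_pos
  have h4 := E.dens_pos
  have h5 : 0 < p.adi - 1 := by linarith
  rw [h0, zero_mul] at h
  have : 0 < 2 * (p.adi - 1) * E.rad * E.kap / (E.dens * p.adi) := by positivity
  linarith

theorem omg_ne_zero (k : ℕ) : E.omg (k + 1) ≠ 0 := by
  have h1 := E.kap_pos
  have h2 := E.rad_pos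
  have h3 := E.dens_pos
  have h4 := Real.pi_pos
  have hk : ((k + 1 : ℕ) : ℝ) ≠ 0 := by exact_mod_cast Nat.succ_ne_zero k
  rw [E.omg_succ]
  have : 0 < E.rad * E.kap / E.dens * √(Real.pi / 2) := by positivity
  exact mul_ne_zero this.ne' (mul_ne_zero (pow_ne_zero _ (by norm_num)) hk)

/-- The linearized system. -/
def modeSystem : ModeSystem where
  S := E.slope
  G := (p.gasConst * p.temp : ℝ)
  A := E.cA
  B := E.cB
  C := E.cC
  c k := E.coeff (k + 1)
  w k := E.omg (k + 1)
  a k := quadSeq E.rate k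
  S_ne := by exact_mod_cast E.slope_pos.ne'
  C_ne := by exact_mod_cast E.cC_pos.ne'
  G_ne := by exact_mod_cast (gas_pos (p := p)).ne'
  c_ne k := by exact_mod_cast E.coeff_ne_zero k
  w_ne k := by exact_mod_cast E.omg_ne_zero k
  a_inj := Complex.ofReal_injective.comp (quadSeq_injective E.rate_pos)
  c_mem := by
    rw [memℓp_two_iff_summable]
    refine (summable_congr fun k => ?_).2 (summable_inv_succ_sq.mul_left
      (((2 : ℝ) ^ (3 / 2 : ℝ) * (p.adi - 1) / (√Real.pi * p.adi)) ^ 2))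
    rw [E.coeff_succ, Complex.norm_real, Real.norm_eq_abs, sq_abs, mul_pow,
      div_pow ((-1 : ℝ) ^ k), ← pow_mul, mul_comm k 2, pow_mul]
    simp
  w_mem z := by
    obtain ⟨K, hK⟩ := exists_bound_inv_quadSeq E.rate_pos z
    rw [memℓp_two_iff_summable]
    refine Summable.of_nonneg_of_le (fun k => by positivity) (fun k => ?_)
      (summable_inv_succ_sq.mul_left ((E.rad * E.kap / E.dens * √(Real.pi / 2)) ^ 2 * K ^ 2))
    have hk : ((k + 1 : ℕ) : ℝ) ≠ 0 := by exact_mod_cast Nat.succ_ne_zero k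
    rw [norm_mul, mul_pow, E.omg_succ, Complex.norm_real, Real.norm_eq_abs, sq_abs]
    have h1 := pow_le_pow_left₀ (norm_nonneg _) (hK k) 2
    have h2 : ((-1 : ℝ) ^ k) ^ 2 = 1 := by rw [← pow_mul, mul_comm, pow_mul]; norm_num
    refine (mul_le_mul_of_nonneg_left h1 (sq_nonneg _)).trans (le_of_eq ?_)
    rw [mul_pow _ ((-1 : ℝ) ^ k * _), mul_pow ((-1 : ℝ) ^ k), h2]
    field_simp
  bdd z := by
    obtain ⟨K, hK⟩ := exists_bound_inv_quadSeq E.rate_pos z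
    refine ⟨|K|, fun k => (hK k).trans ?_⟩
    have h1 : (1 : ℝ) ≤ ((k + 1 : ℕ) : ℝ) := by exact_mod_cast Nat.succ_pos k
    have h2 : 1 / (((k + 1 : ℕ) : ℝ) ^ 2) ≤ 1 := by
      rw [div_le_one (by positivity)]
      exact one_le_pow₀ h1
    calc K * (1 / (((k + 1 : ℕ) : ℝ) ^ 2)) ≤ |K| * (1 / (((k + 1 : ℕ) : ℝ) ^ 2)) := by
          gcongr; exact le_abs_self K
      _ ≤ |K| * 1 := by gcongr
      _ = |K| := mul_one _

/-- Every other row is finite, or a multiple of the series in row 0 up to finitely many entries;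
hence this row decides absolute convergence of all of them. -/
theorem summable_row_zero_iff (x : ℕ → ℂ) :
    (Summable fun j => (E.linMatrix.map fun r : ℝ => (r : ℂ)) 0 j * x j) ↔
      Summable fun k => E.modeSystem.w k * x (k + 3) := by
  rw [← summable_nat_add_iff 3]
  have hS : (E.slope : ℂ) ≠ 0 := by exact_mod_cast E.slope_pos.ne'
  refine (summable_congr fun k => ?_).trans (summable_mul_left_iff hS)
  simp only [Matrix.map_apply, linMatrix, modeSystem]
  push_cast
  ring

theorem hasSum_row {x : ℕ → ℂ} (hx : Summable fun k => E.modeSystem.w k * x (k + 3)) (i : ℕ) :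
    HasSum (fun j => (E.linMatrix.map fun r : ℝ => (r : ℂ)) i j * x j)
      (E.modeSystem.row x i) := by
  have hs := hx.hasSum
  rw [← hasSum_nat_add_iff' 3]
  have hz : ∀ {v : ℂ}, v = 0 → HasSum (fun _ : ℕ => (0 : ℂ)) v := by
    rintro _ rfl
    exact hasSum_zero
  match i with
  | 0 =>
    refine (hs.mul_left (E.slope : ℂ)).of_eq (fun k => ?_) ?_
    · simp only [Matrix.map_apply, linMatrix, modeSystem]
      push_cast
      ring
    · simp only [Finset.sum_range_succ, Matrix.map_apply, linMatrix, ModeSystem.row,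
        ModeSystem.flux, modeSystem]
      push_cast
      simp
      ring
  | 1 =>
    simp only [Matrix.map_apply, linMatrix, Complex.ofReal_zero, zero_mul]
    refine hz ?_
    simp [Finset.sum_range_succ, ModeSystem.row]
  | 2 =>
    simp only [Matrix.map_apply, linMatrix, Complex.ofReal_zero, zero_mul]
    refine hz ?_
    have h1 := E.rad_pos
    have h2 := E.out_pos
    have h3 := E.radTilde_pos
    have h4 := p.liqDensity_pos
    have h5 := p.volBar_pos
    have e1 : (2 * p.sig * E.out ^ 4 + 2 * p.sigBar * E.rad ^ 4) /
      (p.liqDensity * E.radTilde * E.rad ^ 2 * E.out ^ 4) = E.cA / E.cC := by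
      unfold cA cC
      field_simp
    have e2 : -4 * p.visc * p.volBar /
      (p.liqDensity * E.radTilde * E.rad * (E.rad ^ 3 + p.volBar)) = -(E.cB / E.cC) := by
      unfold cB cC
      field_simp
    have e0 : p.gasConst * p.temp / (p.liqDensity * E.radTilde) =
      p.gasConst * p.temp / E.cC := rfl
    simp only [Finset.sum_range_succ, Finset.sum_range_zero, ModeSystem.row, e0, e1, e2]
    simp only [modeSystem]
    push_cast
    ring
  | k + 3 =>
    -- The diagonal damping term, written as a series with one nonzero summand.
    have hk := hasSum_ite_eq k (-((quadSeq E.rate k : ℝ) : ℂ) * x (k + 3))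
    refine ((hs.mul_left (-(E.coeff (k + 1) : ℂ) * E.slope)).add hk).of_eq (fun j => ?_) ?_
    · simp only [Matrix.map_apply, linMatrix, modeSystem]
      by_cases h : k = j
      · subst h
        simp only [if_true, quadSeq, rate, eigv]
        push_cast
        ring
      · rw [if_neg h, if_neg (Ne.symm h)]
        push_cast
        ring
    · simp only [Finset.sum_range_succ, Matrix.map_apply, linMatrix, ModeSystem.row,
        ModeSystem.flux, modeSystem]
      push_cast
      simp
      ring

theorem realizes : E.modeSystem.Realizes E.linOp := by
  refine ⟨fun x => ?_, fun x i => ?_⟩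
  · change ((∀ i, Summable fun j => (E.linMatrix.map fun r : ℝ => (r : ℂ)) i j * x j) ∧
      Memℓp (fun i => ∑' j, (E.linMatrix.map fun r : ℝ => (r : ℂ)) i j * x j) 2) ↔ _
    constructor
    · rintro ⟨h1, h2⟩
      have hx := (E.summable_row_zero_iff x).1 (h1 0)
      refine ⟨hx, ?_⟩
      simpa only [fun i => (E.hasSum_row hx i).tsum_eq] using h2
    · rintro ⟨hx, h2⟩
      refine ⟨fun i => (E.hasSum_row hx i).summable, ?_⟩
      simpa only [fun i => (E.hasSum_row hx i).tsum_eq] using h2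
  · have hx := (E.summable_row_zero_iff _).1 (x.2.1 0)
    exact (E.hasSum_row hx i).tsum_eq

/-! ### Identification of the characteristic function -/

theorem modeSystem_Q (z : ℂ) : E.modeSystem.Q z = E.quad z := rfl

theorem polePt_succ (k : ℕ) : E.polePt (k + 1) = -(quadSeq E.rate k : ℝ) := by
  unfold polePt quadSeq rate
  push_cast
  ring

/-- `∑ 1 / (a_k + z)`. -/
def resSum (z : ℂ) : ℂ := ∑' k, ((quadSeq E.rate k : ℝ) + z)⁻¹

theorem modeSystem_N (z : ℂ) : E.modeSystem.N z = (E.rad / (p.adi * E.dens) : ℝ) *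
    (1 / 3 + 2 * (p.adi - 1) * E.kap * E.resSum z) := by
  have h0 : (p.adi : ℂ) ≠ 0 := by exact_mod_cast (zero_lt_one.trans p.one_lt_adi).ne'
  have h1 : (E.dens : ℂ) ≠ 0 := by exact_mod_cast E.dens_pos.ne'
  have h2 : (E.rad : ℂ) ≠ 0 := by exact_mod_cast E.rad_pos.ne'
  have h3 : ∀ k, E.modeSystem.c k * (E.modeSystem.w k * (E.modeSystem.a k + z)⁻¹) =
      (2 * (p.adi - 1) * E.rad * E.kap / (E.dens * p.adi) : ℝ) *
        ((quadSeq E.rate k : ℝ) + z)⁻¹ := by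
    intro k
    rw [← mul_assoc, ← E.coeff_mul_omg k, Complex.ofReal_mul]
    rfl
  simp only [ModeSystem.N, h3]
  rw [tsum_mul_left]
  change 1 / ((E.slope : ℝ) : ℂ) + _ * E.resSum z = _
  unfold slope
  push_cast
  field_simp

theorem charM_eq (z : ℂ) : E.charM z =
    (4 * Real.pi * E.dens / (E.rad * (p.gasConst * p.temp)) : ℝ) *
      (E.modeSystem.N z * E.modeSystem.Q z + E.modeSystem.G) := by
  have h0 : (p.adi : ℂ) ≠ 0 := by exact_mod_cast (zero_lt_one.trans p.one_lt_adi).ne'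
  have h1 : (E.dens : ℂ) ≠ 0 := by exact_mod_cast E.dens_pos.ne'
  have h2 : (E.rad : ℂ) ≠ 0 := by exact_mod_cast E.rad_pos.ne'
  have h3 : (p.gasConst : ℂ) ≠ 0 := by exact_mod_cast p.gasConst_pos.ne'
  have h4 : (p.temp : ℂ) ≠ 0 := by exact_mod_cast p.temp_pos.ne'
  have h5 : ∑' k : ℕ, ((8 * (p.adi - 1) * E.kap : ℝ) : ℂ)
      / ((Real.pi ^ 2 * E.kap * ((k + 1 : ℕ) : ℝ) ^ 2 : ℝ) + z) =
      (8 * (p.adi - 1) * E.kap : ℝ) * E.resSum z := by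
    rw [resSum, ← tsum_mul_left]
    rfl
  rw [charM, h5, E.modeSystem_N, E.modeSystem_Q]
  change _ = _ * (_ + ((p.gasConst * p.temp : ℝ) : ℂ))
  push_cast
  field_simp
  ring

theorem charM_eq_zero_iff (z : ℂ) : E.charM z = 0 ↔
    E.modeSystem.N z * E.modeSystem.Q z + E.modeSystem.G = 0 := by
  have h1 := E.dens_pos
  have h2 := E.rad_pos
  have h3 := gas_pos (p := p)
  have h4 := Real.pi_pos
  have : 4 * Real.pi * E.dens / (E.rad * (p.gasConst * p.temp)) ≠ 0 := by positivity
  rw [E.charM_eq, mul_eq_zero, Complex.ofReal_eq_zero, or_iff_right this]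

theorem zerosM_eq : E.zerosM = {z | (∀ k, E.modeSystem.a k + z ≠ 0) ∧
    E.modeSystem.N z * E.modeSystem.Q z + E.modeSystem.G = 0} := by
  ext z
  refine and_congr ?_ (E.charM_eq_zero_iff z)
  constructor
  · intro h k hk
    refine h (k + 1) (Nat.succ_pos k) ?_
    rw [E.polePt_succ]
    exact eq_neg_of_add_eq_zero_right hk
  · rintro h (_ | k) h1 hk
    · omega
    · rw [E.polePt_succ] at hk
      exact h k (by rw [hk]; exact add_neg_cancel _)

theorem resonances_eq : E.resonances =
    {z | ∃ m, E.modeSystem.a m + z = 0 ∧ E.modeSystem.Q z = 0} := by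
  ext z
  constructor
  · rintro ⟨_ | k, h1, hk, hQ⟩
    · omega
    · rw [E.polePt_succ] at hk
      exact ⟨k, by rw [hk]; exact add_neg_cancel _, hQ⟩
  · rintro ⟨k, hk, hQ⟩
    refine ⟨k + 1, Nat.succ_pos k, ?_, hQ⟩
    rw [E.polePt_succ]
    exact eq_neg_of_add_eq_zero_right hk

theorem spectrum_linOp :
    UnboundedOp.spectrum E.linOp = {0} ∪ E.zerosM ∪ E.resonances := by
  rw [E.realizes.spectrum_eq, E.zerosM_eq, E.resonances_eq]

end Equilibrium

end GasLiquidParams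

end

/-! ### Disc estimates, meromorphy and the spectral gap -/

noncomputable section

/-- A convex combination of points of the open disc `τ |w|² < Re w` stays in the disc. -/
theorem tsum_mem_disc {τ : ℝ} (hτ : 0 < τ) {u : ℕ → ℝ} {w : ℕ → ℂ} (hu : ∀ k, 0 < u k)
    (hu1 : HasSum u 1) (hw : ∀ k, τ * ‖w k‖ ^ 2 < (w k).re) {F : ℂ}
    (hF : HasSum (fun k => (u k : ℂ) * w k) F) : τ * ‖F‖ ^ 2 < F.re := by
  -- The region τ |w|² < Re w is the open disc with centre and radius c, so the triangle inequality
  -- suffices; one strict summand keeps the result strict.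
  set c : ℝ := 1 / (2 * τ) with hc
  have hc0 : 0 < c := by positivity
  have hcτ : 2 * τ * c = 1 := by rw [hc]; field_simp
  have key : ∀ v : ℂ, ‖v - c‖ ^ 2 = ‖v‖ ^ 2 - 2 * c * v.re + c ^ 2 := by
    intro v
    rw [← Complex.normSq_eq_norm_sq, ← Complex.normSq_eq_norm_sq, Complex.normSq_apply,
      Complex.normSq_apply]
    simp
    ring
  have iff : ∀ v : ℂ, ‖v - c‖ < c ↔ τ * ‖v‖ ^ 2 < v.re := by
    intro v
    rw [← pow_lt_pow_iff_left₀ (norm_nonneg _) hc0.le two_ne_zero, key]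
    constructor <;> intro h
    · have := mul_lt_mul_of_pos_left h hτ
      nlinarith
    · nlinarith
  rw [← iff]
  have h1 : HasSum (fun k => (u k : ℂ) * (w k - c)) (F - c) := by
    refine (hF.sub ((Complex.hasSum_ofReal.2 hu1).mul_right (c : ℂ))).of_eq
      (fun k => by ring) (by simp)
  have h2 : ∀ k, ‖(u k : ℂ) * (w k - c)‖ < u k * c := by
    intro k
    rw [norm_mul, Complex.norm_real, Real.norm_eq_abs, abs_of_pos (hu k)]
    exact mul_lt_mul_of_pos_left ((iff _).2 (hw k)) (hu k)
  have h3 := hu1.mul_right c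
  rw [one_mul] at h3
  have h4 : Summable fun k => ‖(u k : ℂ) * (w k - c)‖ :=
    Summable.of_nonneg_of_le (fun k => norm_nonneg _) (fun k => (h2 k).le) h3.summable
  rw [← h1.tsum_eq]
  calc ‖∑' k, (u k : ℂ) * (w k - c)‖ ≤ ∑' k, ‖(u k : ℂ) * (w k - c)‖ := norm_tsum_le_tsum_norm h4
    _ < ∑' k, u k * c := h4.tsum_lt_tsum (fun k => (h2 k).le) (h2 0) h3.summable
    _ = c := h3.tsum_eq

/-- The real part of `Q` when `Q (1 + g F)` is a negative constant and `F` lies in a disc. -/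
theorem re_lt_of_mul_eq {g q D τ : ℝ} (hg : 0 < g) (hq : 1 + g < q) (hD : 0 < D)
    (hτ : τ = g / (q - 1)) {F Q : ℂ} (hF : τ * ‖F‖ ^ 2 < F.re)
    (h : Q * (1 + g * F) = -(q * D : ℝ)) : Q.re < -D := by
  have hq1 : 0 < q - 1 := by linarith
  have hτ0 : 0 < τ := by rw [hτ]; positivity
  have hτq : τ * (q - 1) = g := by rw [hτ]; field_simp
  have hn : ‖F‖ ^ 2 = F.re ^ 2 + F.im ^ 2 := by
    rw [← Complex.normSq_eq_norm_sq, Complex.normSq_apply]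
    ring
  rw [hn] at hF
  have hf : 0 < F.re := lt_of_le_of_lt (by positivity) hF
  have h1 : τ * F.re < 1 := by nlinarith [sq_nonneg F.im]
  have hre := congrArg Complex.re h
  have him := congrArg Complex.im h
  simp at hre him
  have h2 : Q.re * ((1 + g * F.re) ^ 2 + (g * F.im) ^ 2) = -(q * D) * (1 + g * F.re) := by
    linear_combination (1 + g * F.re) * hre + (g * F.im) * him
  have hu : 0 < 1 + g * F.re := by positivity
  have h3 : g * (F.re ^ 2 + F.im ^ 2) < (q - 1) * F.re := by
    rw [← hτq]
    nlinarith
  -- For u = 1 + g F this says |u|² < q Re u, that is Re (1/u) > 1/q, and Q = -q D / u.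
  have h4 : (1 + g * F.re) ^ 2 + (g * F.im) ^ 2 < q * (1 + g * F.re) := by
    have h5 : g * F.re < q - 1 := by rw [← hτq]; nlinarith
    nlinarith
  have h6 : 0 < (1 + g * F.re) ^ 2 + (g * F.im) ^ 2 := by positivity
  have h7 : ((1 + g * F.re) ^ 2 + (g * F.im) ^ 2) * (Q.re + D) < 0 := by nlinarith
  have h8 := neg_of_mul_neg_right h7 h6.le
  linarith

/-- The imaginary part of `Q` when `Q (1 + g F)` is a negative constant. -/
theorem im_of_mul_eq {g c : ℝ} {F Q : ℂ} (h : Q * (1 + g * F) = -(c : ℝ)) :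
    c * Q.im = g * F.im * ‖Q‖ ^ 2 := by
  have hre := congrArg Complex.re h
  have him := congrArg Complex.im h
  simp at hre him
  rw [← Complex.normSq_eq_norm_sq, Complex.normSq_apply]
  linear_combination Q.im * hre - Q.re * him

theorem normSq_ofReal_add (a : ℝ) (z : ℂ) :
    Complex.normSq (a + z) = (a + z.re) ^ 2 + z.im ^ 2 := by
  rw [Complex.normSq_apply]
  simp
  ring

namespace GasLiquidParams.Equilibrium

variable {p : GasLiquidParams} (E : p.Equilibrium)

/-! ### Meromorphy -/

/-- Finitely many terms are split off. For the others |a_k + z| ≥ a_k / 2 on the unit disc about z₀,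
so the tail converges uniformly to a holomorphic function. -/
theorem meromorphicAt_resSum (z₀ : ℂ) : MeromorphicAt E.resSum z₀ := by
  have hα := E.rate_pos
  obtain ⟨N, hN⟩ := exists_nat_gt (2 * (‖z₀‖ + 1) / E.rate)
  rw [div_lt_iff₀ hα] at hN
  have hlarge : ∀ k, 2 * (‖z₀‖ + 1) ≤ quadSeq E.rate (k + N) := by
    intro k
    refine hN.le.trans ?_
    have h1 : (N : ℝ) ≤ ((k + N + 1 : ℕ) : ℝ) ^ 2 := by
      have : N ≤ (k + N + 1) ^ 2 :=
        (by omega : N ≤ k + N + 1).trans (Nat.le_self_pow two_ne_zero _)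
      exact_mod_cast this
    unfold quadSeq
    rw [mul_comm]
    gcongr
  have hlow : ∀ k, ∀ z ∈ Metric.ball z₀ 1,
      quadSeq E.rate (k + N) / 2 ≤ ‖((quadSeq E.rate (k + N) : ℝ) : ℂ) + z‖ := by
    intro k z hz
    have h1 : ‖z‖ ≤ ‖z₀‖ + 1 := by
      have h2 : ‖z - z₀‖ < 1 := by simpa [dist_eq_norm] using hz
      have h3 := norm_add_le (z - z₀) z₀
      rw [sub_add_cancel] at h3
      linarith
    have h4 := norm_sub_le (((quadSeq E.rate (k + N) : ℝ) : ℂ) + z) z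
    rw [add_sub_cancel_right, Complex.norm_real, Real.norm_eq_abs,
      abs_of_pos (quadSeq_pos hα _)] at h4
    have := hlarge k
    linarith
  have htail : DifferentiableOn ℂ
      (fun z => ∑' k, (((quadSeq E.rate (k + N) : ℝ) : ℂ) + z)⁻¹) (Metric.ball z₀ 1) := by
    refine Complex.differentiableOn_tsum_of_summable_norm
      (u := fun k => 2 * (1 / quadSeq E.rate (k + N)))
      (((summable_nat_add_iff N).2 (summable_inv_quadSeq E.rate)).mul_left 2)
      (fun k z hz => ?_) Metric.isOpen_ball (fun k z hz => ?_)
    · have h1 := hlow k z hz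
      have h2 := quadSeq_pos hα (k + N)
      have h3 : ((quadSeq E.rate (k + N) : ℝ) : ℂ) + z ≠ 0 := by
        rw [← norm_pos_iff]
        linarith
      exact (((differentiableAt_const _).add differentiableAt_id).inv h3).differentiableWithinAt
    · have h1 := hlow k z hz
      have h2 := quadSeq_pos hα (k + N)
      rw [norm_inv]
      calc _ ≤ (quadSeq E.rate (k + N) / 2)⁻¹ := by gcongr
        _ = _ := by field_simp
  have heq : E.resSum = fun z =>
      ∑ k ∈ Finset.range N, (((quadSeq E.rate k : ℝ) : ℂ) + z)⁻¹ +
        ∑' k, (((quadSeq E.rate (k + N) : ℝ) : ℂ) + z)⁻¹ := by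
    ext z
    exact ((summable_inv_quadSeq_add hα z).sum_add_tsum_nat_add N).symm
  rw [heq]
  refine MeromorphicAt.add (MeromorphicAt.fun_sum fun k _ => ?_) ?_
  · exact ((MeromorphicAt.const _ _).add (MeromorphicAt.id _)).inv
  · exact (htail.analyticAt (Metric.ball_mem_nhds z₀ one_pos)).meromorphicAt

theorem meromorphic_charM : Meromorphic E.charM := by
  intro z₀
  have h1 : E.charM = fun z => (4 * Real.pi * E.dens / (E.rad * (p.gasConst * p.temp)) : ℝ) *
      (((E.rad / (p.adi * E.dens) : ℝ) * (1 / 3 + 2 * (p.adi - 1) * E.kap * E.resSum z)) *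
        (E.cC * z ^ 2 + E.cB * z - E.cA) + (p.gasConst * p.temp : ℝ)) := by
    ext z
    rw [E.charM_eq, E.modeSystem_N]
    rfl
  rw [h1]
  have h2 := E.meromorphicAt_resSum z₀
  fun_prop

/-! ### The spectral gap -/

theorem qRatio_mul : E.qRatio * (E.cK * E.cC + E.cA) = 3 / 2 * p.adi * (E.cK * E.cC) := by
  have h1 := E.rad_pos
  have h2 := E.cA_pos
  have h3 := mul_pos E.cK_pos E.cC_pos
  have h4 : 0 < E.cK * E.cC + E.cA := by positivity
  have h5 : E.qRatio = 3 * p.gasConst * p.temp * E.dens * p.adi / E.rad /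
      (E.cK * E.cC + E.cA) := by
    rw [qRatio, div_div]
  rw [h5, div_mul_cancel₀ _ h4.ne', E.cK_mul_cC]
  field_simp

/-- The normalized sum `∑ pₖ aₖ / (aₖ + z)` with `pₖ = 6 / (π² k²)`. -/
def normSum (z : ℂ) : ℂ := (6 * E.kap : ℝ) * E.resSum z

/-- The weights are normalized so that the constant 1/3 in N becomes 1 and the series becomes γ - 1
times an average. -/
theorem quad_mul_eq {z : ℂ} (hz : E.charM z = 0) :
    E.quad z * (1 + ((p.adi - 1 : ℝ) : ℂ) * E.normSum z) =
      -(E.qRatio * (E.cK * E.cC + E.cA) : ℝ) := by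
  rw [E.charM_eq_zero_iff, E.modeSystem_N, E.modeSystem_Q] at hz
  change _ + ((p.gasConst * p.temp : ℝ) : ℂ) = 0 at hz
  rw [E.qRatio_mul, E.cK_mul_cC]
  have h0 : (p.adi : ℂ) ≠ 0 := by exact_mod_cast (zero_lt_one.trans p.one_lt_adi).ne'
  have h1 : (E.dens : ℂ) ≠ 0 := by exact_mod_cast E.dens_pos.ne'
  have h2 : (E.rad : ℂ) ≠ 0 := by exact_mod_cast E.rad_pos.ne'
  unfold normSum
  push_cast at hz ⊢
  field_simp at hz ⊢
  linear_combination hz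

theorem quad_re (z : ℂ) :
    (E.quad z).re = E.cC * (z.re ^ 2 - z.im ^ 2) + E.cB * z.re - E.cA := by
  change ((E.cC : ℂ) * z ^ 2 + (E.cB : ℂ) * z - (E.cA : ℂ)).re = _
  simp [pow_two]

theorem quad_im (z : ℂ) : (E.quad z).im = z.im * (2 * E.cC * z.re + E.cB) := by
  change ((E.cC : ℂ) * z ^ 2 + (E.cB : ℂ) * z - (E.cA : ℂ)).im = _
  simp [pow_two]
  ring

theorem one_sub_theta2_pos : 0 < 1 - E.theta2 := by
  have h1 := p.one_lt_adi
  have h2 := E.adi_lt_qRatio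
  unfold theta2
  rw [sub_sub_cancel]
  exact div_pos (by linarith) (by linarith)

theorem theta2_pos : 0 < E.theta2 := by
  have h1 := p.one_lt_adi
  have h2 := E.adi_lt_qRatio
  unfold theta2
  rw [sub_pos, div_lt_one (by linarith)]
  linarith

theorem hasSum_weights : HasSum (fun k => 6 * E.kap / quadSeq E.rate k) 1 := by
  -- The term of index 0 in the series for ζ(2) is 1 / 0² = 0, so the shift loses nothing.
  have h := (hasSum_nat_add_iff' 1).2 hasSum_zeta_two
  have h1 := h.mul_left (6 / Real.pi ^ 2)
  have hk := E.kap_pos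
  have hpi := Real.pi_pos
  refine h1.of_eq (fun k => ?_) ?_
  · unfold quadSeq rate
    field_simp
  · simp

/-- The point a / (a + z) lies in the disc exactly when Re z > -Θ₂ a; since a ≥ π² κ̄, the
hypothesis covers every mode, and averaging preserves the disc. -/
theorem normSum_mem_disc {z : ℂ} (hz : -(E.theta2 * E.rate) < z.re) :
    (1 - E.theta2) * ‖E.normSum z‖ ^ 2 < (E.normSum z).re := by
  have hα := E.rate_pos
  have hτ := E.one_sub_theta2_pos
  have hθ := E.theta2_pos
  have hk := E.kap_pos
  have hpos : ∀ k, 0 < quadSeq E.rate k := quadSeq_pos hα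
  refine tsum_mem_disc hτ (fun k => by have := hpos k; positivity) E.hasSum_weights
    (w := fun k => (quadSeq E.rate k : ℝ) * ((quadSeq E.rate k : ℝ) + z)⁻¹) (fun k => ?_)
    (((summable_inv_quadSeq_add hα z).hasSum.mul_left ((6 * E.kap : ℝ) : ℂ)).of_eq
      (fun k => ?_) rfl)
  · have ha := hpos k
    have hle := le_quadSeq hα k
    set a := quadSeq E.rate k
    have hx : (1 - E.theta2) * a < a + z.re := by nlinarith
    have hx0 : 0 < a + z.re := lt_trans (by positivity) hx
    have hn : 0 < Complex.normSq (a + z) := by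
      rw [normSq_ofReal_add]
      positivity
    rw [norm_mul, mul_pow, norm_inv, inv_pow, ← Complex.normSq_eq_norm_sq ((a : ℂ) + z),
      Complex.norm_real, Real.norm_eq_abs, sq_abs, Complex.re_ofReal_mul, Complex.inv_re]
    rw [show ((a : ℂ) + z).re = a + z.re by simp]
    rw [← mul_assoc, ← div_eq_mul_inv, mul_div_assoc', div_lt_div_iff_of_pos_right hn]
    nlinarith
  · have : ((quadSeq E.rate k : ℝ) : ℂ) ≠ 0 := by exact_mod_cast (hpos k).ne'
    push_cast
    field_simp

theorem quad_re_lt {z : ℂ} (hM : E.charM z = 0) (hz : -(E.theta2 * E.rate) < z.re) :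
    (E.quad z).re < -(E.cK * E.cC + E.cA) := by
  have h1 := p.one_lt_adi
  have h2 := E.adi_lt_qRatio
  have h3 := mul_pos E.cK_pos E.cC_pos
  refine re_lt_of_mul_eq (g := p.adi - 1) (q := E.qRatio) (by linarith) (by linarith)
    (by linarith [E.cA_pos]) ?_ (E.normSum_mem_disc hz) (E.quad_mul_eq hM)
  unfold theta2
  rw [sub_sub_cancel]

theorem hasSum_normSum_im (z : ℂ) : HasSum
    (fun k => z.im * (1 / Complex.normSq ((quadSeq E.rate k : ℝ) + z)))
    (-(E.normSum z).im / (6 * E.kap)) := by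
  have hk := E.kap_pos
  have h := (Complex.hasSum_im (summable_inv_quadSeq_add E.rate_pos z).hasSum).neg
  refine h.of_eq (fun k => ?_) ?_
  · rw [Complex.inv_im]
    simp
    ring
  · rw [normSum, Complex.im_ofReal_mul, resSum]
    field_simp

/-- The imaginary part of the characteristic equation. -/
theorem damping_identity {z : ℂ} (hM : E.charM z = 0) (hy : z.im ≠ 0) :
    (Summable fun k => 1 / Complex.normSq ((quadSeq E.rate k : ℝ) + z)) ∧
    p.adi * (E.cK * E.cC) * (2 * E.cC * z.re + E.cB) =
      -(4 * E.kap * (p.adi - 1) * ‖E.quad z‖ ^ 2 *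
        ∑' k, 1 / Complex.normSq ((quadSeq E.rate k : ℝ) + z)) := by
  have hk := E.kap_pos
  have hs := E.hasSum_normSum_im z
  have hsum := (summable_mul_left_iff hy).1 hs.summable
  refine ⟨hsum, ?_⟩
  have h1 := im_of_mul_eq (E.quad_mul_eq hM)
  rw [E.qRatio_mul, E.quad_im] at h1
  have h2 := hs.tsum_eq
  rw [tsum_mul_left, eq_div_iff (by positivity)] at h2
  refine mul_left_cancel₀ hy ?_
  -- The factor 2/3 undoes q (K C + A) = (3/2) γ K C and turns 6 κ̄ into 4 κ̄.
  linear_combination 2 / 3 * h1 + 2 / 3 * (p.adi - 1) * ‖E.quad z‖ ^ 2 * h2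

theorem re_lt_of_im_ne_zero {z : ℂ} (hM : E.charM z = 0) (hz : -(E.theta2 * E.rate) < z.re)
    (hy : z.im ≠ 0) : 2 * E.cC * z.re + E.cB < 0 := by
  obtain ⟨hs, h⟩ := E.damping_identity hM hy
  have h1 := p.one_lt_adi
  have h2 := mul_pos E.cK_pos E.cC_pos
  have h3 : E.quad z ≠ 0 := by
    intro h0
    have := E.quad_re_lt hM hz
    rw [h0, Complex.zero_re] at this
    linarith [E.cA_pos]
  have h4 : 0 < ‖E.quad z‖ := norm_pos_iff.2 h3
  have hpos : ∀ k, 0 < 1 / Complex.normSq (((quadSeq E.rate k : ℝ) : ℂ) + z) := by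
    intro k
    rw [normSq_ofReal_add]
    have : 0 < z.im ^ 2 := by positivity
    positivity
  have h5 := hs.tsum_pos (fun k => (hpos k).le) 0 (hpos 0)
  have h6 := E.kap_pos
  have h7 : 0 < p.adi - 1 := by linarith
  have h8 : p.adi * (E.cK * E.cC) * (2 * E.cC * z.re + E.cB) < 0 := by
    rw [h, neg_lt_zero]
    positivity
  exact neg_of_mul_neg_right h8 (by positivity)

/-- The additional damping of the non-real eigenvalues near the imaginary axis. -/
theorem re_le_of_sq_le {z : ℂ} (hM : E.charM z = 0) (hz : -(E.theta2 * E.rate) < z.re)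
    (hy : z.im ≠ 0) (hx2 : z.re ^ 2 ≤ E.cK / 2) :
    z.re ≤ -(E.cB / (2 * E.cC) + E.extraDamping) := by
  obtain ⟨hs, h⟩ := E.damping_identity hM hy
  have hK := E.cK_pos
  have hC := E.cC_pos
  have hA := E.cA_pos
  have hB := E.cB_pos
  have hα := E.rate_pos
  have hk := E.kap_pos
  have hγ := p.one_lt_adi
  have hneg := E.re_lt_of_im_ne_zero hM hz hy
  have hx0 : z.re < 0 := by
    by_contra hc
    have := mul_nonneg hC.le (not_lt.1 hc)
    linarith
  have hre := E.quad_re_lt hM hz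
  have hR := E.quad_re z
  set R := -(E.quad z).re with hRdef
  have hR1 : E.cK * E.cC ≤ R := by linarith
  have hR2 : E.cC * (z.im ^ 2 - E.cK / 2) ≤ R := by nlinarith
  have hKC := mul_pos hK hC
  -- From K C · C (y² - K/2) ≤ R² and (K C)² ≤ R² one gets K C² y² ≤ (3/2) R².
  have hR3 : E.cK * E.cC ^ 2 * z.im ^ 2 ≤ 2 * R ^ 2 := by
    have e1 : (E.cK * E.cC) * (E.cC * (z.im ^ 2 - E.cK / 2)) ≤ (E.cK * E.cC) * R :=
      mul_le_mul_of_nonneg_left hR2 hKC.le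
    have e2 : (E.cK * E.cC) * R ≤ R * R := mul_le_mul_of_nonneg_right hR1 (by linarith)
    have e3 : (E.cK * E.cC) * (E.cK * E.cC) ≤ (E.cK * E.cC) * R :=
      mul_le_mul_of_nonneg_left hR1 hKC.le
    nlinarith
  have hQR : R ^ 2 ≤ ‖E.quad z‖ ^ 2 := by
    rw [← Complex.normSq_eq_norm_sq, Complex.normSq_apply, hRdef]
    nlinarith [mul_self_nonneg (E.quad z).im]
  have hterm : ∀ k, (E.cK * E.cC) ^ 2 * (1 / (quadSeq E.rate k ^ 2 + E.cK / 2)) ≤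
      4 * ‖E.quad z‖ ^ 2 * (1 / Complex.normSq ((quadSeq E.rate k : ℝ) + z)) := by
    intro k
    have ha := quadSeq_pos hα k
    have hle := le_quadSeq hα k
    have hθ : E.theta2 < 1 := by linarith [E.one_sub_theta2_pos]
    set a := quadSeq E.rate k
    have hy2 : 0 < z.im ^ 2 := by positivity
    rw [normSq_ofReal_add, mul_one_div, mul_one_div,
      div_le_div_iff₀ (by positivity) (by positivity)]
    -- Since -a < x < 0, replacing (a + x)² by a² only enlarges it; y² is traded for K/2 by the
    -- bound on K C² y².
    have hxa : -a < z.re := by nlinarith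
    have e1 : (a + z.re) ^ 2 ≤ a ^ 2 := by nlinarith
    have e2 : (E.cK * E.cC) ^ 2 * a ^ 2 ≤ 4 * R ^ 2 * a ^ 2 := by
      have : (E.cK * E.cC) ^ 2 ≤ R ^ 2 := pow_le_pow_left₀ hKC.le hR1 2
      nlinarith [sq_nonneg a, sq_nonneg R]
    calc (E.cK * E.cC) ^ 2 * ((a + z.re) ^ 2 + z.im ^ 2)
        ≤ (E.cK * E.cC) ^ 2 * (a ^ 2 + z.im ^ 2) := by gcongr
      _ ≤ 4 * R ^ 2 * (a ^ 2 + E.cK / 2) := by nlinarith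
      _ ≤ 4 * ‖E.quad z‖ ^ 2 * (a ^ 2 + E.cK / 2) := by gcongr
  have hs1 := hs.mul_left (4 * ‖E.quad z‖ ^ 2)
  have hs2 : Summable fun k =>
      (E.cK * E.cC) ^ 2 * (1 / (quadSeq E.rate k ^ 2 + E.cK / 2)) :=
    Summable.of_nonneg_of_le (fun k => by positivity) hterm hs1
  have hcmp := hs2.tsum_le_tsum hterm hs1
  rw [tsum_mul_left, tsum_mul_left] at hcmp
  have hδ : E.extraDamping = (p.adi - 1) * E.kap * E.cK / (2 * p.adi) *
      ∑' k, 1 / (quadSeq E.rate k ^ 2 + E.cK / 2) := by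
    unfold extraDamping
    congr 2
    ext k
    unfold quadSeq rate
    ring
  set H := ∑' k, 1 / Complex.normSq (((quadSeq E.rate k : ℝ) : ℂ) + z)
  set H2 := ∑' k, 1 / (quadSeq E.rate k ^ 2 + E.cK / 2)
  have hg : 0 < p.adi - 1 := by linarith
  have h3 : p.adi * (E.cK * E.cC) * (2 * E.cC * z.re + E.cB) ≤
      -(E.kap * (p.adi - 1) * ((E.cK * E.cC) ^ 2 * H2)) := by
    rw [h]
    have := mul_le_mul_of_nonneg_left hcmp (mul_pos hk hg).le
    linarith
  have h4 : p.adi * (E.cK * E.cC) * (2 * E.cC * z.re + E.cB) ≤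
      p.adi * (E.cK * E.cC) * (-(2 * E.cC * E.extraDamping)) := by
    refine h3.trans (le_of_eq ?_)
    rw [hδ]
    field_simp
  have h5 := le_of_mul_le_mul_left h4 (by positivity)
  have h6 : E.cB = 2 * E.cC * (E.cB / (2 * E.cC)) := by field_simp
  rw [h6] at h5
  have h7 : 2 * E.cC * z.re ≤ 2 * E.cC * (-(E.cB / (2 * E.cC) + E.extraDamping)) := by linarith
  exact le_of_mul_le_mul_left h7 (by positivity)

theorem extraDamping_nonneg : 0 ≤ E.extraDamping := by
  have hK := E.cK_pos
  have hk := E.kap_pos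
  have hγ : 0 < p.adi - 1 := by linarith [p.one_lt_adi]
  have hγ' : 0 < p.adi := by linarith
  unfold extraDamping
  refine mul_nonneg (by positivity) (tsum_nonneg fun k => by positivity)

theorem gap_pos : 0 < E.gap := by
  have hK := E.cK_pos
  have hC := E.cC_pos
  have hB := E.cB_pos
  have hk := E.kap_pos
  have hθ := E.theta2_pos
  have hδ := E.extraDamping_nonneg
  have hpi := Real.pi_pos
  have h1 : 0 < E.cB / (2 * E.cC) := by positivity
  unfold gap
  split_ifs with h
  · exact mul_pos (by norm_num) (lt_min (by positivity)
      (lt_min (lt_max_of_lt_left h1) (by linarith)))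
  · refine mul_pos (by norm_num) (lt_min (by positivity) (div_pos ?_ (by positivity)))
    rw [sub_pos, Real.sqrt_lt' hB]
    have : 0 < 4 * E.cK * E.cC ^ 2 := by positivity
    linarith

theorem two_mul_gap_le : 2 * E.gap ≤ E.theta2 * E.rate := by
  rw [rate, ← mul_assoc]
  unfold gap
  split_ifs
  all_goals
    rw [← mul_assoc, mul_one_div_cancel two_ne_zero, one_mul]
    exact min_le_left _ _

theorem re_le_of_charM_eq_zero {z : ℂ} (hM : E.charM z = 0) : z.re ≤ -2 * E.gap := by
  by_contra hcon
  push Not at hcon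
  have hz : -(E.theta2 * E.rate) < z.re := by linarith [E.two_mul_gap_le]
  have hK := E.cK_pos
  have hC := E.cC_pos
  have hB := E.cB_pos
  have hre := E.quad_re_lt hM hz
  rw [E.quad_re] at hre
  unfold gap at hcon
  split_ifs at hcon with hcase
  · by_cases hy : z.im = 0
    · rw [hy] at hre
      -- No real zero here: 4C (C x² + B x + K C) = (2 C x + B)² + 4 K C² - B² ≥ 0.
      nlinarith [sq_nonneg (2 * E.cC * z.re + E.cB)]
    · have hneg := E.re_lt_of_im_ne_zero hM hz hy
      have hlt : z.re < -(E.cB / (2 * E.cC)) := by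
        rw [← neg_div, lt_div_iff₀ (by positivity)]
        linarith
      set m1 := max (E.cB / (2 * E.cC)) (min (E.theta1 * Real.pi ^ 2 * E.kap) √(E.cK / 2))
      have e1 : min (E.theta2 * Real.pi ^ 2 * E.kap)
          (min m1 (E.cB / (2 * E.cC) + E.extraDamping)) ≤ m1 :=
        (min_le_right _ _).trans (min_le_left _ _)
      have e2 : min (E.theta2 * Real.pi ^ 2 * E.kap)
          (min m1 (E.cB / (2 * E.cC) + E.extraDamping)) ≤
          E.cB / (2 * E.cC) + E.extraDamping :=
        (min_le_right _ _).trans (min_le_right _ _)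
      have h1 : -m1 < z.re := by linarith
      have h2 : -z.re < √(E.cK / 2) := by
        have h3 : -z.re < m1 := by linarith
        rcases lt_max_iff.1 h3 with h4 | h4
        · linarith
        · exact h4.trans_le (min_le_right _ _)
      have hx0 : 0 ≤ -z.re := by
        have : 0 < E.cB / (2 * E.cC) := by positivity
        linarith
      have h5 : z.re ^ 2 ≤ E.cK / 2 := by
        have h6 := pow_le_pow_left₀ hx0 h2.le 2
        rw [Real.sq_sqrt (by positivity)] at h6
        linarith
      have := E.re_le_of_sq_le hM hz hy h5
      linarith
  · set s := √(E.cB ^ 2 - 4 * E.cK * E.cC ^ 2) with hs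
    have hs0 : 0 ≤ s := Real.sqrt_nonneg _
    have hs2 : s ^ 2 = E.cB ^ 2 - 4 * E.cK * E.cC ^ 2 := Real.sq_sqrt (by linarith)
    have h1 : -((E.cB - s) / (2 * E.cC)) < z.re := by
      have := min_le_right (E.theta2 * Real.pi ^ 2 * E.kap) ((E.cB - s) / (2 * E.cC))
      linarith
    rw [← neg_div, div_lt_iff₀ (by positivity)] at h1
    by_cases hy : z.im = 0
    · rw [hy] at hre
      have h2 : 4 * E.cC * (E.cC * z.re ^ 2 + E.cB * z.re + E.cK * E.cC) < 0 :=
        mul_neg_of_pos_of_neg (by positivity) (by linarith)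
      -- To the right of the larger root of C x² + B x + K C the quadratic cannot be negative.
      have h3 : s < 2 * E.cC * z.re + E.cB := by linarith
      nlinarith
    · have := E.re_lt_of_im_ne_zero hM hz hy
      linarith

/-- These points are at most -π² κ̄, and 2ϖ ≤ Θ₂ π² κ̄ with Θ₂ < 1. -/
theorem re_le_of_resonance {z : ℂ} (hz : z ∈ E.resonances) : z.re ≤ -2 * E.gap := by
  obtain ⟨k, hk, rfl, -⟩ := hz
  obtain ⟨k, rfl⟩ := Nat.exists_eq_succ_of_ne_zero (Nat.one_le_iff_ne_zero.1 hk)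
  have h1 := le_quadSeq E.rate_pos k
  have h2 := E.two_mul_gap_le
  have h3 := E.one_sub_theta2_pos
  have h4 := E.rate_pos
  rw [Nat.succ_eq_add_one, E.polePt_succ, Complex.neg_re, Complex.ofReal_re]
  nlinarith

/-- A zero at the origin would violate the gap; this is the nondegeneracy used for the simplicity of
the eigenvalue 0. -/
theorem charM_zero_ne : E.charM 0 ≠ 0 := by
  intro h
  have := E.re_le_of_charM_eq_zero h
  rw [Complex.zero_re] at this
  linarith [E.gap_pos]

end GasLiquidParams.Equilibrium

end

theorem proposition4p2 (p : GasLiquidParams) (E : p.Equilibrium) :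
    Meromorphic E.charM ∧
    UnboundedOp.spectrum E.linOp = {0} ∪ E.zerosM ∪ E.resonances ∧
    ((∀ k : ℕ, 1 ≤ k → E.quad (E.polePt k) ≠ 0) →
      UnboundedOp.spectrum E.linOp = {0} ∪ E.zerosM) ∧
    Module.finrank ℂ (UnboundedOp.eigenspace E.linOp 0) = 1 ∧
    Module.finrank ℂ (UnboundedOp.genEigenspace E.linOp 0) = 1 ∧
    0 < E.gap ∧
    (∀ z ∈ UnboundedOp.spectrum E.linOp \ {0}, z.re ≤ -2 * E.gap) := by
  have ha : ∀ k, E.modeSystem.a k ≠ 0 := fun k =>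
    Complex.ofReal_ne_zero.2 (quadSeq_pos E.rate_pos k).ne'
  have hd : E.modeSystem.N 0 * E.modeSystem.Q 0 + E.modeSystem.G ≠ 0 := fun h =>
    E.charM_zero_ne ((E.charM_eq_zero_iff 0).2 h)
  refine ⟨E.meromorphic_charM, E.spectrum_linOp, fun h => ?_,
    E.realizes.finrank_eigenspace ha hd, E.realizes.finrank_genEigenspace ha hd,
    E.gap_pos, ?_⟩
  · have : E.resonances = ∅ := by
      refine Set.eq_empty_iff_forall_notMem.2 ?_
      rintro z ⟨k, hk, rfl, hQ⟩
      exact h k hk hQ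
    rw [E.spectrum_linOp, this, Set.union_empty]
  · rw [E.spectrum_linOp]
    rintro z ⟨(h0 | hz) | hz, hn⟩
    · exact absurd h0 hn
    · exact E.re_le_of_charM_eq_zero hz.2
    · exact E.re_le_of_resonance hz
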